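/- Let $(M,g)$ and $(\bar M,\bar g)$ be smooth finite-dimensional Riemannian manifolds without boundary. Let ${\cal D}_1,{\cal D}_2$ be complementary orthogonal smooth distributions on $M$, i.e. smooth subbundles of $TM$ with $TM={\cal D}_1\oplus{\cal D}_2$ and ${\cal D}_1\perp{\cal D}_2$, where ${\cal D}_1$ is spanned by a smooth unit vector field $N$ and $\dim{\cal D}_2=q$. Let $f:(M,g)\to(\bar M,\bar g)$ be an isometric immersion with second fundamental form $\bar h(X,Y)=(\bar\nabla_X\,df(Y))^{\bot}$ (the component normal to $df(TM)$). Put $\bar H=\operatorname{tr}_g\bar h$ and $\bar H_i=\operatorname{tr}_g(\bar h|_{{\cal D}_i\times{\cal D}_i})$ for $i=1,2$ (traces are not divided by the dimension). Let $\operatorname{Ric}$ be the Ricci tensor of $(M,g)$. For orthonormal vectors $E_0,E_1,\dots,E_q\in T_y\bar M$ let $\overline{\operatorname{Ric}}_q(E_0,\dots,E_q)=\sum_{i=1}^q\bar K(E_0,E_i)$ be the $q$-th Ricci curvature of $(\bar M,\bar g)$, where $\bar K$ is the sectional curvature, and let $\bar r_q\in[-\infty,\infty]$ be the supremum of $\overline{\operatorname{Ric}}_q$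 over all such orthonormal systems at all points $y\in\bar M$. Then at every point of $M$ $$\operatorname{Ric}_{N,N}\le\tfrac14\,\|\bar H\|^2+\bar r_q .$$ Equality holds at a point $x\in M$ if and only if, at $x$, $\bar h(X,Y)=0$ for all $X\in{\cal D}_1(x)$ and $Y\in{\cal D}_2(x)$, $\bar H_1=\bar H_2$, and $\overline{\operatorname{Ric}}_q(df(N),df(e_1),\dots,df(e_q))=\bar r_q$ for an orthonormal basis $e_1,\dots,e_q$ of ${\cal D}_2(x)$ (the choice of the basis does not matter). In particular, equality holds at all points of $M$ if and only if $f$ is mixed totally geodesic (i.e. $\bar h(X,Y)=0$ for all $X\in{\cal D}_1$, $Y\in{\cal D}_2$), $\bar H_1=\bar H_2$ on $M$, and $\overline{\operatorname{Ric}}_q(df(N),df(e_1),\dots,df(e_q))=\bar r_q$ at each point of $M$. -/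

import Mathlib

open Bundle
open scoped Manifold ContDiff Topology

noncomputable section

namespace RiemannianImmersion

/-! ## Riemannian geometry in charts

`M` is a smooth manifold modelled on a finite-dimensional real vector space `E`; the
Riemannian metric is Mathlib's `RiemannianBundle` structure on the tangent bundle.  At every point
`x` we work in the preferred chart `φ = extChartAt 𝓘(ℝ, E) x`. -/

section Intrinsic

variable {E : Type*} [NormedAddCommGroup E] [NormedSpace ℝ E] [FiniteDimensional ℝ E]
  {M : Type*} [TopologicalSpace M] [ChartedSpace E M]

instance instFiniteDimensionalTangentSpace (x : M) :
    FiniteDimensional ℝ (TangentSpace 𝓘(ℝ, E) x) :=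
  inferInstanceAs (FiniteDimensional ℝ E)

/-- The differential at `x` of the preferred chart `φ` at `x`. -/
def chartDeriv (x : M) : TangentSpace 𝓘(ℝ, E) x →L[ℝ] E :=
  mfderiv 𝓘(ℝ, E) 𝓘(ℝ, E) (extChartAt 𝓘(ℝ, E) x) x

/-- The differential at `y : E` of the inverse `φ⁻¹` of the preferred chart at `x`. -/
def chartSymmDeriv (x : M) (y : E) :
    E →L[ℝ] TangentSpace 𝓘(ℝ, E) ((extChartAt 𝓘(ℝ, E) x).symm y) :=
  mfderiv 𝓘(ℝ, E) 𝓘(ℝ, E) (extChartAt 𝓘(ℝ, E) x).symm y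

/-- A (smooth) distribution of rank `r`: a family of subspaces of the tangent spaces that is
locally spanned by `r` smooth, pointwise linearly independent vector fields. -/
def IsDistribution [IsManifold 𝓘(ℝ, E) ∞ M]
    (D : ∀ x : M, Submodule ℝ (TangentSpace 𝓘(ℝ, E) x)) (r : ℕ) : Prop :=
  ∀ x₀ : M, ∃ U ∈ 𝓝 x₀, ∃ X : Fin r → ∀ x : M, TangentSpace 𝓘(ℝ, E) x,
    (∀ i, ContMDiffOn 𝓘(ℝ, E) 𝓘(ℝ, E).tangent ∞
      (fun x => (⟨x, X i x⟩ : TangentBundle 𝓘(ℝ, E) M)) U) ∧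
    ∀ x ∈ U, LinearIndependent ℝ (fun i => X i x) ∧
      Submodule.span ℝ (Set.range fun i => X i x) = D x

variable [RiemannianBundle (fun x : M => TangentSpace 𝓘(ℝ, E) x)]

/-- The metric in the preferred chart at `x`:
`G y u v = g (dφ⁻¹ u) (dφ⁻¹ v)` at the point `φ⁻¹ y`. -/
def chartMetric (x : M) (y : E) : E →L[ℝ] E →L[ℝ] ℝ :=
  (innerSL ℝ (E := TangentSpace 𝓘(ℝ, E) ((extChartAt 𝓘(ℝ, E) x).symm y))).bilinearComp
    (chartSymmDeriv x y) (chartSymmDeriv x y)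

/-- The linear form `w ↦ D_u G (v, w) + D_v G (u, w) - D_w G (u, v)` at `y`, where `G` is the
metric in the preferred chart at `x`. -/
def chartKoszul (x : M) (y u v : E) : E →L[ℝ] ℝ :=
  fderiv ℝ (chartMetric x) y u v + fderiv ℝ (chartMetric x) y v u
    - ((fderiv ℝ (chartMetric x) y).flip u).flip v

/-- The Christoffel symbols of the Levi-Civita connection in the preferred chart at `x`:
`Γ y u v` is the vector with `G y (Γ y u v) w = ½ (D_u G (v, w) + D_v G (u, w) - D_w G (u, v))`
for all `w`.  For vector fields `X`, `Y` in the chart, `∇_X Y = D_X Y + Γ (X, Y)`. -/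
def christoffel (x : M) (y u v : E) : E :=
  (chartMetric x y).inverse ((1 / 2 : ℝ) • chartKoszul x y u v)

/-- The Riemann curvature tensor in the preferred chart at `x`, for constant fields `u`, `v`, `w`:
`R (u, v) w = ∇_u ∇_v w - ∇_v ∇_u w`. -/
def chartCurvature (x : M) (y u v w : E) : E :=
  fderiv ℝ (fun z => christoffel x z v w) y u - fderiv ℝ (fun z => christoffel x z u w) y v
    + christoffel x y u (christoffel x y v w) - christoffel x y v (christoffel x y u w)

/-- The curvature tensor `R (u, v) w` at `x`, with the sign convention
`R (X, Y) Z = ∇_X ∇_Y Z - ∇_Y ∇_X Z - ∇_[X, Y] Z`. -/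
def curvature (x : M) (u v w : TangentSpace 𝓘(ℝ, E) x) : TangentSpace 𝓘(ℝ, E) x :=
  (chartDeriv x).inverse
    (chartCurvature x (extChartAt 𝓘(ℝ, E) x x) (chartDeriv x u) (chartDeriv x v) (chartDeriv x w))

/-- `K (u, v) = g (R (u, v) v, u)`, the sectional curvature of the plane spanned by the orthonormal
vectors `u`, `v`. -/
def sectionalCurvature (x : M) (u v : TangentSpace 𝓘(ℝ, E) x) : ℝ :=
  inner ℝ (curvature x u v v) u

/-- The Ricci tensor `Ric (u, v) = trace (w ↦ R (w, u) v)`. -/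
def ricci (x : M) (u v : TangentSpace 𝓘(ℝ, E) x) : ℝ :=
  ∑ a, inner ℝ (curvature x (stdOrthonormalBasis ℝ (TangentSpace 𝓘(ℝ, E) x) a) u v)
    (stdOrthonormalBasis ℝ (TangentSpace 𝓘(ℝ, E) x) a)

/-- The `q`-th Ricci curvature `∑ i = 1, …, q, K (e₀, e_i)` of `q + 1` orthonormal vectors
`e₀, e₁, …, e_q` at `x`. -/
def qRicci {q : ℕ} (x : M) (e : Fin (q + 1) → TangentSpace 𝓘(ℝ, E) x) : ℝ :=
  ∑ i : Fin q, sectionalCurvature x (e 0) (e i.succ)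

variable (E M) in
/-- The supremum of the `q`-th Ricci curvature over all orthonormal `(q + 1)`-tuples at all points,
as an extended real number. -/
def supQRicci (q : ℕ) : EReal :=
  ⨆ (x : M) (e : Fin (q + 1) → TangentSpace 𝓘(ℝ, E) x) (_ : Orthonormal ℝ e),
    (qRicci x e : EReal)

/-- An almost `k`-product structure: `k` pairwise orthogonal complementary distributions `D i` of
ranks `n i`. -/
structure IsAlmostProduct [IsManifold 𝓘(ℝ, E) ∞ M] {k : ℕ}
    (D : Fin k → ∀ x : M, Submodule ℝ (TangentSpace 𝓘(ℝ, E) x))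
    (n : Fin k → ℕ) : Prop where
  isDistribution : ∀ i, IsDistribution (D i) (n i)
  orthogonal : ∀ i j, i ≠ j → ∀ x, D i x ⟂ D j x
  complementary : ∀ x, ⨆ i, D i x = ⊤

end Intrinsic

/-! ## Isometric immersions -/

section Immersion

variable (E : Type*) [NormedAddCommGroup E] [NormedSpace ℝ E] [FiniteDimensional ℝ E]
  {M : Type*} [TopologicalSpace M] [ChartedSpace E M]
  [RiemannianBundle (fun x : M => TangentSpace 𝓘(ℝ, E) x)]
  (E' : Type*) [NormedAddCommGroup E'] [NormedSpace ℝ E'] [FiniteDimensional ℝ E']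
  {M' : Type*} [TopologicalSpace M'] [ChartedSpace E' M']
  [RiemannianBundle (fun x : M' => TangentSpace 𝓘(ℝ, E') x)]

/-- `f` is smooth and its differential preserves the metrics (so it is injective). -/
structure IsIsometricImmersion (f : M → M') : Prop where
  contMDiff : ContMDiff 𝓘(ℝ, E) 𝓘(ℝ, E') ∞ f
  inner_mfderiv : ∀ (x : M) (u v : TangentSpace 𝓘(ℝ, E) x),
    inner ℝ (mfderiv 𝓘(ℝ, E) 𝓘(ℝ, E') f x u) (mfderiv 𝓘(ℝ, E) 𝓘(ℝ, E') f x v) = inner ℝ u v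

/-- The tangent space `df (T_x M)` of the immersed manifold, as a subspace of the ambient tangent
space at `f x`. -/
def tangentImage (f : M → M') (x : M) : Submodule ℝ (TangentSpace 𝓘(ℝ, E') (f x)) :=
  LinearMap.range (mfderiv 𝓘(ℝ, E) 𝓘(ℝ, E') f x).toLinearMap

/-- The ambient covariant derivative `∇̄_u (df Y)` at `f x`, where `Y` is the vector field on `M`
near `x` that has constant components in the preferred chart at `x` and the value `v` at `x`.
With `F` the expression of `f` in the preferred charts at `x` and `f x`, it is
`D²F (u, v) + Γ̄ (DF u, DF v)`. -/
def ambientCovDeriv (f : M → M') (x : M) (u v : TangentSpace 𝓘(ℝ, E) x) :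
    TangentSpace 𝓘(ℝ, E') (f x) :=
  (chartDeriv (f x)).inverse
    (fderiv ℝ (fun y => fderiv ℝ (writtenInExtChartAt 𝓘(ℝ, E) 𝓘(ℝ, E') x f) y (chartDeriv x v))
        (extChartAt 𝓘(ℝ, E) x x) (chartDeriv x u)
      + christoffel (f x) (extChartAt 𝓘(ℝ, E') (f x) (f x))
          (chartDeriv (f x) (mfderiv 𝓘(ℝ, E) 𝓘(ℝ, E') f x u))
          (chartDeriv (f x) (mfderiv 𝓘(ℝ, E) 𝓘(ℝ, E') f x v)))

/-- The second fundamental form `h̄ (u, v)` of `f` at `x`: the component of `∇̄_u (df Y)` normal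
to `df (T_x M)`, where `Y` extends `v`. -/
def secondFundamentalForm (f : M → M') (x : M) (u v : TangentSpace 𝓘(ℝ, E) x) :
    TangentSpace 𝓘(ℝ, E') (f x) :=
  (tangentImage E E' f x)ᗮ.starProjection (ambientCovDeriv E E' f x u v)

/-- The mean curvature vector `H̄ = trace h̄` of `f` (no division by the dimension). -/
def meanCurvature (f : M → M') (x : M) : TangentSpace 𝓘(ℝ, E') (f x) :=
  ∑ a, secondFundamentalForm E E' f x (stdOrthonormalBasis ℝ (TangentSpace 𝓘(ℝ, E) x) a)
    (stdOrthonormalBasis ℝ (TangentSpace 𝓘(ℝ, E) x) a)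

/-- The mean curvature vector of a distribution `D` along `f`: the trace of the restriction of `h̄`
to `D`. -/
def meanCurvatureOn (f : M → M') (D : ∀ x : M, Submodule ℝ (TangentSpace 𝓘(ℝ, E) x)) (x : M) :
    TangentSpace 𝓘(ℝ, E') (f x) :=
  ∑ a, secondFundamentalForm E E' f x (stdOrthonormalBasis ℝ (D x) a : TangentSpace 𝓘(ℝ, E) x)
    (stdOrthonormalBasis ℝ (D x) a : TangentSpace 𝓘(ℝ, E) x)

/-- `h̄ (X, Y) = 0` at `x` for `X`, `Y` in two different distributions of the family `D`. -/
def MixedTotallyGeodesicAt {k : ℕ} (f : M → M')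
    (D : Fin k → ∀ x : M, Submodule ℝ (TangentSpace 𝓘(ℝ, E) x)) (x : M) : Prop :=
  ∀ i j, i ≠ j → ∀ X ∈ D i x, ∀ Y ∈ D j x, secondFundamentalForm E E' f x X Y = 0

/-- `f` is mixed totally geodesic with respect to the family `D`. -/
def MixedTotallyGeodesic {k : ℕ} (f : M → M')
    (D : Fin k → ∀ x : M, Submodule ℝ (TangentSpace 𝓘(ℝ, E) x)) : Prop :=
  ∀ x, MixedTotallyGeodesicAt E E' f D x

/-- The ambient `q`-th Ricci curvature of the orthonormal vectors `df (N x), df e₁, …, df e_q`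
equals its supremum over the ambient manifold, where `e₁, …, e_q` is an orthonormal basis of the
`q`-dimensional space `D x` (the choice of the basis does not matter). -/
def AttainsSupQRicciAt (f : M → M') (N : ∀ x : M, TangentSpace 𝓘(ℝ, E) x)
    (D : ∀ x : M, Submodule ℝ (TangentSpace 𝓘(ℝ, E) x)) (q : ℕ) (x : M) : Prop :=
  ∃ e : OrthonormalBasis (Fin q) ℝ (D x),
    (qRicci (f x) (Fin.cons (mfderiv 𝓘(ℝ, E) 𝓘(ℝ, E') f x (N x))
      (fun i => mfderiv 𝓘(ℝ, E) 𝓘(ℝ, E') f x (e i : TangentSpace 𝓘(ℝ, E) x))) : EReal)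
      = supQRicci E' M' q

end Immersion

end RiemannianImmersion

end

open RiemannianImmersion

set_option maxSynthPendingDepth 3
set_option synthInstance.maxHeartbeats 100000
set_option linter.unusedSectionVars false

/-! Complete `N` by an orthonormal basis `e i` of the second distribution, so that `Ric (N, N)` is
the sum of the `K (N, e i)`. The Gauss equation gives `K (N, e i) = K̄ (N, e i) + ⟨h (N, N), h (e i,
e i)⟩ - ‖h (N, e i)‖²`. As the first distribution is a line, `H₁ = h (N, N)`, and the scalar
products add up to `⟨H₁, H₂⟩ = ¼ ‖H₁ + H₂‖² - ¼ ‖H₁ - H₂‖²` with `H₁ + H₂ = H`. Hence the exact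
identity `IsIsometricImmersion.ricci_eq`: Ricci is `¼ ‖H‖²` plus the ambient `q`-th Ricci curvature
minus a sum of squares. Bounding the ambient term by its supremum gives the inequality; equality
means that all squares vanish and the supremum is attained (`ereal_le_and_eq_iff`).

Most of the work is the Gauss equation, proved in charts in `IsIsometricNear.gauss`. The curvature
form consists of derivatives of the Koszul form of `G` and products of Christoffel symbols. For `G =
F^* G'` the Koszul form is also `G' (∇̄_u DF v, DF w)`, so the same derivatives can be computed in
the ambient space, where they produce the ambient curvature. `IsIsometricImmersion.gauss` then
separates tangential from normal parts. -/

namespace RiemannianImmersion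

noncomputable section

/-! ### Levi-Civita calculus and the Gauss equation on a vector space -/

section Calculus

variable {E : Type*} [NormedAddCommGroup E] [NormedSpace ℝ E]
  {E' : Type*} [NormedAddCommGroup E'] [NormedSpace ℝ E']

/-- The trilinear form `(u, v, w) ↦ T u v w + T v u w - T w u v`. -/
def koszulForm (T : E →L[ℝ] E →L[ℝ] E →L[ℝ] ℝ) : E →L[ℝ] E →L[ℝ] E →L[ℝ] ℝ :=
  T + T.flip - (ContinuousLinearMap.flipₗᵢ ℝ E E ℝ).toContinuousLinearEquiv.toContinuousLinearMap
    ∘L T.flip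

@[simp] lemma koszulForm_apply (T : E →L[ℝ] E →L[ℝ] E →L[ℝ] ℝ) (u v w : E) :
    koszulForm T u v w = T u v w + T v u w - T w u v := rfl

/-- The Christoffel symbols of the field of bilinear forms `G`, as a bilinear map. -/
def christoffelMap (G : E → E →L[ℝ] E →L[ℝ] ℝ) (y : E) : E →L[ℝ] E →L[ℝ] E :=
  (ContinuousLinearMap.compL ℝ E (E →L[ℝ] ℝ) E (G y).inverse) ∘L
    ((1 / 2 : ℝ) • koszulForm (fderiv ℝ G y))

lemma christoffelMap_apply (G : E → E →L[ℝ] E →L[ℝ] ℝ) (y u v : E) :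
    christoffelMap G y u v = (G y).inverse ((1 / 2 : ℝ) • koszulForm (fderiv ℝ G y) u v) := rfl

/-- The curvature of the Levi-Civita connection of `G` on constant fields. -/
def flatCurvature (G : E → E →L[ℝ] E →L[ℝ] ℝ) (y u v w : E) : E :=
  fderiv ℝ (fun z => christoffelMap G z v w) y u - fderiv ℝ (fun z => christoffelMap G z u w) y v
    + christoffelMap G y u (christoffelMap G y v w)
    - christoffelMap G y v (christoffelMap G y u w)

/-- `G` is a smooth field of nondegenerate symmetric bilinear forms near `y`. -/
structure IsMetricNear (G : E → E →L[ℝ] E →L[ℝ] ℝ) (y : E) : Prop where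
  eventually_contDiffAt : ∀ᶠ z in 𝓝 y, ContDiffAt ℝ ∞ G z
  symm : ∀ᶠ z in 𝓝 y, ∀ u v, G z u v = G z v u
  isInvertible : ∀ᶠ z in 𝓝 y, (G z).IsInvertible

namespace IsMetricNear

variable {G : E → E →L[ℝ] E →L[ℝ] ℝ} {y : E}

lemma contDiffAt (h : IsMetricNear G y) : ContDiffAt ℝ ∞ G y :=
  h.eventually_contDiffAt.self_of_nhds

lemma eventually (h : IsMetricNear G y) : ∀ᶠ z in 𝓝 y, IsMetricNear G z := by
  filter_upwards [h.eventually_contDiffAt.eventually_nhds, h.symm.eventually_nhds,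
    h.isInvertible.eventually_nhds] with z h1 h2 h3 using ⟨h1, h2, h3⟩

lemma hasFDerivAt (h : IsMetricNear G y) : HasFDerivAt G (fderiv ℝ G y) y :=
  (h.contDiffAt.differentiableAt (by simp)).hasFDerivAt

/-- Symmetry of `G` holds on a neighbourhood, so it can be differentiated. -/
lemma fderiv_symm (h : IsMetricNear G y) (a u v : E) :
    fderiv ℝ G y a u v = fderiv ℝ G y a v u := by
  have h1 : HasFDerivAt (fun z => G z u v) (((fderiv ℝ G y).flip u).flip v) y := by
    refine ((h.hasFDerivAt.clm_apply (hasFDerivAt_const u y)).clm_apply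
      (hasFDerivAt_const v y)).congr_fderiv ?_
    ext; simp
  have h2 : HasFDerivAt (fun z => G z u v) (((fderiv ℝ G y).flip v).flip u) y := by
    have : HasFDerivAt (fun z => G z v u) (((fderiv ℝ G y).flip v).flip u) y := by
      refine ((h.hasFDerivAt.clm_apply (hasFDerivAt_const v y)).clm_apply
        (hasFDerivAt_const u y)).congr_fderiv ?_
      ext; simp
    refine this.congr_of_eventuallyEq ?_
    filter_upwards [h.symm] with z hz using hz u v
  exact congrArg (fun L => L a) (h1.unique h2)

lemma apply_christoffelMap (h : IsMetricNear G y) (u v w : E) :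
    G y (christoffelMap G y u v) w = 1 / 2 * koszulForm (fderiv ℝ G y) u v w := by
  rw [christoffelMap_apply, h.isInvertible.self_of_nhds.self_apply_inverse]
  rfl

lemma christoffelMap_symm (h : IsMetricNear G y) (u v : E) :
    christoffelMap G y u v = christoffelMap G y v u := by
  rw [christoffelMap_apply, christoffelMap_apply]
  congr 2
  ext w
  simp only [koszulForm_apply]
  rw [h.fderiv_symm w u v]
  ring

/-- Metric compatibility: in the sum of the two Koszul expressions all terms cancel except the
derivative along `u`, which occurs twice with factor one half. -/
lemma fderiv_eq (h : IsMetricNear G y) (u a b : E) :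
    fderiv ℝ G y u a b = G y (christoffelMap G y u a) b + G y a (christoffelMap G y u b) := by
  rw [h.symm.self_of_nhds a, h.apply_christoffelMap, h.apply_christoffelMap]
  simp only [koszulForm_apply]
  rw [h.fderiv_symm u b a, h.fderiv_symm a u b, h.fderiv_symm b u a]
  ring

lemma contDiffAt_fderiv (h : IsMetricNear G y) : ContDiffAt ℝ ∞ (fderiv ℝ G) y :=
  h.contDiffAt.fderiv_right (by simp)

/-- Inversion is smooth at an invertible operator, and the Koszul form depends linearly on `DG`. -/
lemma contDiffAt_christoffelMap [CompleteSpace E] (h : IsMetricNear G y) :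
    ContDiffAt ℝ ∞ (christoffelMap G) y := by
  have h1 : ContDiffAt ℝ ∞ (fun z => (G z).inverse) y :=
    ContDiffAt.comp y (h.isInvertible.self_of_nhds.contDiffAt_map_inverse) h.contDiffAt
  have h2 : ContDiffAt ℝ ∞ (fun z => koszulForm (fderiv ℝ G z)) y := by
    have hd := h.contDiffAt_fderiv
    have hf : ContDiffAt ℝ ∞ (fun z => (fderiv ℝ G z).flip) y :=
      (ContinuousLinearMap.flipₗᵢ ℝ E E (E →L[ℝ] ℝ)).contDiff.contDiffAt.comp y hd
    exact (hd.add hf).sub (contDiffAt_const.clm_comp hf)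
  exact ((ContinuousLinearMap.compL ℝ E (E →L[ℝ] ℝ) E).contDiff.contDiffAt.comp y h1).clm_comp
    (h2.const_smul _)

lemma hasFDerivAt_christoffelMap [CompleteSpace E] (h : IsMetricNear G y) :
    HasFDerivAt (christoffelMap G) (fderiv ℝ (christoffelMap G) y) y :=
  (h.contDiffAt_christoffelMap.differentiableAt (by simp)).hasFDerivAt

lemma fderiv_christoffelMap_apply [CompleteSpace E] (h : IsMetricNear G y) (u v w : E) :
    fderiv ℝ (fun z => christoffelMap G z v w) y u = fderiv ℝ (christoffelMap G) y u v w := by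
  rw [((h.hasFDerivAt_christoffelMap.clm_apply (hasFDerivAt_const v y)).clm_apply
    (hasFDerivAt_const w y)).fderiv]
  simp

/-- Leibniz rule for `G (Γ (v, w), z)`, which equals half the Koszul form at all nearby points. -/
lemma fderiv_koszul [CompleteSpace E] (h : IsMetricNear G y) (u v w z : E) :
    fderiv ℝ (fun t => 1 / 2 * koszulForm (fderiv ℝ G t) v w z) y u
      = fderiv ℝ G y u (christoffelMap G y v w) z
        + G y (fderiv ℝ (christoffelMap G) y u v w) z := by
  have h1 := ((h.hasFDerivAt.clm_apply ((h.hasFDerivAt_christoffelMap.clm_apply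
    (hasFDerivAt_const v y)).clm_apply (hasFDerivAt_const w y)))).clm_apply (hasFDerivAt_const z y)
  have h2 : (fun t => 1 / 2 * koszulForm (fderiv ℝ G t) v w z)
      =ᶠ[𝓝 y] fun t => G t (christoffelMap G t v w) z := by
    filter_upwards [h.eventually] with t ht using (ht.apply_christoffelMap v w z).symm
  rw [h2.fderiv_eq, h1.fderiv]
  simp
  ring

/-- The curvature form in terms of derivatives of the Koszul form. -/
lemma apply_flatCurvature [CompleteSpace E] (h : IsMetricNear G y) (u v w z : E) :
    G y (flatCurvature G y u v w) z
      = fderiv ℝ (fun t => 1 / 2 * koszulForm (fderiv ℝ G t) v w z) y u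
        - fderiv ℝ (fun t => 1 / 2 * koszulForm (fderiv ℝ G t) u w z) y v
        - G y (christoffelMap G y v w) (christoffelMap G y u z)
        + G y (christoffelMap G y u w) (christoffelMap G y v z) := by
  rw [h.fderiv_koszul, h.fderiv_koszul, h.fderiv_eq u, h.fderiv_eq v, flatCurvature,
    h.fderiv_christoffelMap_apply, h.fderiv_christoffelMap_apply]
  simp
  ring

/-- Symmetrising half the Koszul form in its last two arguments leaves `D_v G (w, z)`; this is
differentiated once more. -/
lemma fderiv_koszul_add [CompleteSpace E] (h : IsMetricNear G y) (u v w z : E) :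
    fderiv ℝ (fun t => 1 / 2 * koszulForm (fderiv ℝ G t) v w z) y u
      + fderiv ℝ (fun t => 1 / 2 * koszulForm (fderiv ℝ G t) v z w) y u
      = fderiv ℝ (fderiv ℝ G) y u v w z := by
  have hd : HasFDerivAt (fderiv ℝ G) (fderiv ℝ (fderiv ℝ G) y) y :=
    (h.contDiffAt_fderiv.differentiableAt (by simp)).hasFDerivAt
  have key : ∀ a b c : E, HasFDerivAt (fun t => fderiv ℝ G t a b c)
      ((((fderiv ℝ (fderiv ℝ G) y).flip a).flip b).flip c) y := by
    intro a b c
    refine (((hd.clm_apply (hasFDerivAt_const a y)).clm_apply (hasFDerivAt_const b y)).clm_apply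
      (hasFDerivAt_const c y)).congr_fderiv ?_
    ext; simp
  have h1 : ∀ w z : E, HasFDerivAt (fun t => 1 / 2 * koszulForm (fderiv ℝ G t) v w z) _ y :=
    fun w z => (((key v w z).add (key w v z)).sub (key z v w)).const_mul (1 / 2)
  have hs : ∀ a b c, fderiv ℝ (fderiv ℝ G) y u a b c = fderiv ℝ (fderiv ℝ G) y u a c b := by
    intro a b c
    have h2 : (fun t => fderiv ℝ G t a b c) =ᶠ[𝓝 y] fun t => fderiv ℝ G t a c b := by
      filter_upwards [h.eventually] with t ht using ht.fderiv_symm a b c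
    exact congrArg (fun L => L u) ((key a b c).unique ((key a c b).congr_of_eventuallyEq h2))
  rw [(h1 w z).fderiv, (h1 z w).fderiv]
  simp
  rw [hs v z w, hs w v z, hs z v w]
  ring

/-- After symmetrising in `w` and `z`, the Christoffel products cancel and the rest is the
commutator of second derivatives of `G`, zero by Schwarz. -/
lemma apply_flatCurvature_skew [CompleteSpace E] (h : IsMetricNear G y) (u v w z : E) :
    G y (flatCurvature G y u v w) z = - G y (flatCurvature G y u v z) w := by
  have h1 := h.fderiv_koszul_add u v w z
  have h2 := h.fderiv_koszul_add v u w z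
  have h3 : fderiv ℝ (fderiv ℝ G) y u v = fderiv ℝ (fderiv ℝ G) y v u :=
    (h.contDiffAt.isSymmSndFDerivAt (by simpa using ENat.LEInfty.out)).eq u v
  rw [h3] at h1
  rw [h.apply_flatCurvature, h.apply_flatCurvature,
    h.symm.self_of_nhds (christoffelMap G y v w), h.symm.self_of_nhds (christoffelMap G y u w)]
  linarith

end IsMetricNear

lemma flatCurvature_antisymm (G : E → E →L[ℝ] E →L[ℝ] ℝ) (y u v w : E) :
    flatCurvature G y u v w = - flatCurvature G y v u w := by
  simp only [flatCurvature]
  abel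

section Immersion

variable {G : E → E →L[ℝ] E →L[ℝ] ℝ} {G' : E' → E' →L[ℝ] E' →L[ℝ] ℝ} {F : E → E'} {y : E}

/-- The covariant derivative of `DF v` in the direction `u`, for constant fields `u`, `v`. -/
def flatCovDeriv (G' : E' → E' →L[ℝ] E' →L[ℝ] ℝ) (F : E → E') (y u v : E) : E' :=
  fderiv ℝ (fderiv ℝ F) y u v + christoffelMap G' (F y) (fderiv ℝ F y u) (fderiv ℝ F y v)

/-- `F` is a smooth isometric immersion of the metric `G` into the metric `G'` near `y`. -/
structure IsIsometricNear (G : E → E →L[ℝ] E →L[ℝ] ℝ) (G' : E' → E' →L[ℝ] E' →L[ℝ] ℝ)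
    (F : E → E') (y : E) : Prop where
  left : IsMetricNear G y
  right : IsMetricNear G' (F y)
  eventually_contDiffAt : ∀ᶠ z in 𝓝 y, ContDiffAt ℝ ∞ F z
  isometric : ∀ᶠ z in 𝓝 y, ∀ u v, G z u v = G' (F z) (fderiv ℝ F z u) (fderiv ℝ F z v)

namespace IsIsometricNear

lemma contDiffAt (h : IsIsometricNear G G' F y) : ContDiffAt ℝ ∞ F y :=
  h.eventually_contDiffAt.self_of_nhds

lemma eventually (h : IsIsometricNear G G' F y) : ∀ᶠ z in 𝓝 y, IsIsometricNear G G' F z := by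
  filter_upwards [h.left.eventually, h.contDiffAt.continuousAt.eventually h.right.eventually,
    h.eventually_contDiffAt.eventually_nhds, h.isometric.eventually_nhds] with z h1 h2 h3 h4
    using ⟨h1, h2, h3, h4⟩

lemma hasFDerivAt (h : IsIsometricNear G G' F y) : HasFDerivAt F (fderiv ℝ F y) y :=
  (h.contDiffAt.differentiableAt (by simp)).hasFDerivAt

lemma contDiffAt_fderiv (h : IsIsometricNear G G' F y) : ContDiffAt ℝ ∞ (fderiv ℝ F) y :=
  h.contDiffAt.fderiv_right (by simp)

lemma hasFDerivAt_fderiv (h : IsIsometricNear G G' F y) :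
    HasFDerivAt (fderiv ℝ F) (fderiv ℝ (fderiv ℝ F) y) y :=
  (h.contDiffAt_fderiv.differentiableAt (by simp)).hasFDerivAt

lemma hasFDerivAt_fderiv_fderiv (h : IsIsometricNear G G' F y) :
    HasFDerivAt (fderiv ℝ (fderiv ℝ F)) (fderiv ℝ (fderiv ℝ (fderiv ℝ F)) y) y :=
  ((h.contDiffAt_fderiv.fderiv_right (m := ∞) (by simp)).differentiableAt
    (by simp)).hasFDerivAt

lemma fderiv_fderiv_symm (h : IsIsometricNear G G' F y) (u v : E) :
    fderiv ℝ (fderiv ℝ F) y u v = fderiv ℝ (fderiv ℝ F) y v u :=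
  (h.contDiffAt.isSymmSndFDerivAt (by simpa using ENat.LEInfty.out)).eq u v

lemma fderiv_fderiv_fderiv_symm (h : IsIsometricNear G G' F y) (u v : E) :
    fderiv ℝ (fderiv ℝ (fderiv ℝ F)) y u v = fderiv ℝ (fderiv ℝ (fderiv ℝ F)) y v u :=
  (h.contDiffAt_fderiv.isSymmSndFDerivAt (by simpa using ENat.LEInfty.out)).eq u v

/-- Chain and Leibniz rules applied to `G = F^* G'` near `y`. -/
lemma fderiv_metric (h : IsIsometricNear G G' F y) (u v w : E) :
    fderiv ℝ G y u v w
      = fderiv ℝ G' (F y) (fderiv ℝ F y u) (fderiv ℝ F y v) (fderiv ℝ F y w)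
        + G' (F y) (fderiv ℝ (fderiv ℝ F) y u v) (fderiv ℝ F y w)
        + G' (F y) (fderiv ℝ F y v) (fderiv ℝ (fderiv ℝ F) y u w) := by
  have h1 := (h.left.hasFDerivAt.clm_apply (hasFDerivAt_const v y)).clm_apply
    (hasFDerivAt_const w y)
  have h2 := ((h.right.hasFDerivAt.comp y h.hasFDerivAt).clm_apply
    (h.hasFDerivAt_fderiv.clm_apply (hasFDerivAt_const v y))).clm_apply
    (h.hasFDerivAt_fderiv.clm_apply (hasFDerivAt_const w y))
  have h3 : (fun z => G z v w)
      =ᶠ[𝓝 y] fun z => (G' ∘ F) z (fderiv ℝ F z v) (fderiv ℝ F z w) := by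
    filter_upwards [h.isometric] with z hz using hz v w
  have h4 := congrArg (fun L => L u) (h1.unique (h2.congr_of_eventuallyEq h3))
  simp at h4
  rw [h4]
  ring

/-- The tangential part of the covariant derivative is given by the Koszul form. -/
lemma apply_flatCovDeriv (h : IsIsometricNear G G' F y) (u v w : E) :
    G' (F y) (flatCovDeriv G' F y u v) (fderiv ℝ F y w)
      = 1 / 2 * koszulForm (fderiv ℝ G y) u v w := by
  simp only [flatCovDeriv, map_add, _root_.add_apply,
    h.right.apply_christoffelMap, koszulForm_apply, h.fderiv_metric]
  have hs := h.right.symm.self_of_nhds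
  rw [hs (fderiv ℝ F y u), hs (fderiv ℝ F y u), hs (fderiv ℝ F y v),
    h.fderiv_fderiv_symm v u, h.fderiv_fderiv_symm w u, h.fderiv_fderiv_symm w v]
  ring

lemma flatCovDeriv_symm (h : IsIsometricNear G G' F y) (u v : E) :
    flatCovDeriv G' F y u v = flatCovDeriv G' F y v u := by
  rw [flatCovDeriv, flatCovDeriv, h.fderiv_fderiv_symm, h.right.christoffelMap_symm]

/-- The covariant derivative is tangent up to a `G'`-normal vector. -/
lemma apply_flatCovDeriv_sub (h : IsIsometricNear G G' F y) (u v w : E) :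
    G' (F y) (flatCovDeriv G' F y u v - fderiv ℝ F y (christoffelMap G y u v))
      (fderiv ℝ F y w) = 0 := by
  rw [map_sub, _root_.sub_apply, h.apply_flatCovDeriv,
    ← h.isometric.self_of_nhds, h.left.apply_christoffelMap, sub_self]

variable [CompleteSpace E']

/-- The derivative of the covariant derivative `flatCovDeriv`. -/
lemma hasFDerivAt_flatCovDeriv (h : IsIsometricNear G G' F y) (v w : E) :
    ∃ L : E →L[ℝ] E', HasFDerivAt (fun z => flatCovDeriv G' F z v w) L y ∧
      ∀ u, L u = fderiv ℝ (fderiv ℝ (fderiv ℝ F)) y u v w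
        + fderiv ℝ (christoffelMap G') (F y) (fderiv ℝ F y u) (fderiv ℝ F y v) (fderiv ℝ F y w)
        + christoffelMap G' (F y) (fderiv ℝ (fderiv ℝ F) y u v) (fderiv ℝ F y w)
        + christoffelMap G' (F y) (fderiv ℝ F y v) (fderiv ℝ (fderiv ℝ F) y u w) := by
  refine ⟨_, ((h.hasFDerivAt_fderiv_fderiv.clm_apply (hasFDerivAt_const v y)).clm_apply
    (hasFDerivAt_const w y)).add
    (((h.right.hasFDerivAt_christoffelMap.comp y h.hasFDerivAt).clm_apply
    (h.hasFDerivAt_fderiv.clm_apply (hasFDerivAt_const v y))).clm_apply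
    (h.hasFDerivAt_fderiv.clm_apply (hasFDerivAt_const w y))), fun u => ?_⟩
  simp
  abel

/-- The Koszul form is now differentiated through `G' (∇̄_v DF w, DF z)`. Compatibility of `G'`
moves the derivative onto both factors; on the second it gives `∇̄_u DF z`. -/
lemma fderiv_koszul (h : IsIsometricNear G G' F y) (u v w z : E) :
    fderiv ℝ (fun t => 1 / 2 * koszulForm (fderiv ℝ G t) v w z) y u
      = G' (F y) (fderiv ℝ (fun t => flatCovDeriv G' F t v w) y u
          + christoffelMap G' (F y) (fderiv ℝ F y u) (flatCovDeriv G' F y v w)) (fderiv ℝ F y z)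
        + G' (F y) (flatCovDeriv G' F y v w) (flatCovDeriv G' F y u z) := by
  obtain ⟨L, hL, -⟩ := h.hasFDerivAt_flatCovDeriv v w
  have h2 := ((h.right.hasFDerivAt.comp y h.hasFDerivAt).clm_apply hL).clm_apply
    (h.hasFDerivAt_fderiv.clm_apply (hasFDerivAt_const z y))
  have h3 : (fun t => 1 / 2 * koszulForm (fderiv ℝ G t) v w z)
      =ᶠ[𝓝 y] fun t => (G' ∘ F) t (flatCovDeriv G' F t v w) (fderiv ℝ F t z) := by
    filter_upwards [h.eventually] with t ht using (ht.apply_flatCovDeriv v w z).symm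
  rw [h3.fderiv_eq, h2.fderiv, hL.fderiv]
  simp
  rw [h.right.fderiv_eq, flatCovDeriv.eq_1 _ _ _ u z]
  simp
  ring

/-- The **Gauss equation**, for constant fields in the domain. -/
lemma gauss [CompleteSpace E] (h : IsIsometricNear G G' F y) (u v w z : E) :
    G y (flatCurvature G y u v w) z
      = G' (F y) (flatCurvature G' (F y) (fderiv ℝ F y u) (fderiv ℝ F y v) (fderiv ℝ F y w))
          (fderiv ℝ F y z)
        + G' (F y) (flatCovDeriv G' F y v w) (flatCovDeriv G' F y u z)
        - G' (F y) (flatCovDeriv G' F y u w) (flatCovDeriv G' F y v z)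
        - G y (christoffelMap G y v w) (christoffelMap G y u z)
        + G y (christoffelMap G y u w) (christoffelMap G y v z) := by
  -- The statement uses full ambient derivatives and subtracts Christoffel products, so no normal
  -- projection is needed here.
  rw [h.left.apply_flatCurvature, h.fderiv_koszul, h.fderiv_koszul]
  obtain ⟨L, hL, hL'⟩ := h.hasFDerivAt_flatCovDeriv v w
  obtain ⟨K, hK, hK'⟩ := h.hasFDerivAt_flatCovDeriv u w
  -- The commutator of ambient covariant derivatives along `F` is the ambient curvature: third
  -- derivatives of `F` and the terms with `D²F (u, v)` cancel by symmetry.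
  have key : flatCurvature G' (F y) (fderiv ℝ F y u) (fderiv ℝ F y v) (fderiv ℝ F y w)
      = (L u + christoffelMap G' (F y) (fderiv ℝ F y u) (flatCovDeriv G' F y v w))
      - (K v + christoffelMap G' (F y) (fderiv ℝ F y v) (flatCovDeriv G' F y u w)) := by
    rw [hL', hK', h.fderiv_fderiv_fderiv_symm u v, h.fderiv_fderiv_symm v u]
    simp only [flatCovDeriv, flatCurvature, h.right.fderiv_christoffelMap_apply, map_add]
    abel
  rw [hL.fderiv, hK.fderiv, key, map_sub, _root_.sub_apply]
  ring

end IsIsometricNear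

end Immersion

end Calculus

/-! ### The Riemannian metric in the preferred chart -/

section Charts

/-- A bilinear form on a finite-dimensional space with trivial kernel is invertible. -/
lemma isInvertible_of_injective {E : Type*} [NormedAddCommGroup E] [NormedSpace ℝ E]
    [FiniteDimensional ℝ E] (B : E →L[ℝ] E →L[ℝ] ℝ) (hB : Function.Injective B) :
    B.IsInvertible := by
  have hfin : Module.finrank ℝ E = Module.finrank ℝ (E →L[ℝ] ℝ) := by
    rw [← (LinearMap.toContinuousLinearMap (𝕜 := ℝ) (E := E) (F' := ℝ)).finrank_eq]
    exact (Subspace.dual_finrank_eq (K := ℝ) (V := E)).symm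
  exact ⟨(LinearEquiv.ofInjectiveOfFinrankEq B.toLinearMap hB hfin).toContinuousLinearEquiv,
    by ext; rfl⟩

variable {E : Type*} [NormedAddCommGroup E] [NormedSpace ℝ E] [FiniteDimensional ℝ E]
  {M : Type*} [TopologicalSpace M] [ChartedSpace E M] [IsManifold 𝓘(ℝ, E) ∞ M]

/-- The tangent space at `x` is by definition the model space, identified through the preferred
chart at `x`; that chart therefore has the identity as differential at its centre. -/
lemma chartDeriv_eq_id (x : M) : chartDeriv (E := E) x = ContinuousLinearMap.id ℝ E :=
  have : IsManifold 𝓘(ℝ, E) 1 M := .of_le (n := ∞) (by simp)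
  mfderiv_extChartAt_self

lemma chartSymmDeriv_self (x : M) :
    chartSymmDeriv x (extChartAt 𝓘(ℝ, E) x x) = ContinuousLinearMap.id ℝ E := by
  have : IsManifold 𝓘(ℝ, E) 1 M := .of_le (n := ∞) (by simp)
  have h := mfderivWithin_range_extChartAt_symm (I := 𝓘(ℝ, E)) (x := x)
  rw [ModelWithCorners.range_eq_univ, mfderivWithin_univ] at h
  exact h

lemma chartSymmDeriv_injective (x : M) {y : E} (hy : y ∈ (extChartAt 𝓘(ℝ, E) x).target) :
    Function.Injective (chartSymmDeriv x y) := by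
  have : IsManifold 𝓘(ℝ, E) 1 M := .of_le (n := ∞) (by simp)
  have h := isInvertible_mfderivWithin_extChartAt_symm hy
  rw [ModelWithCorners.range_eq_univ, mfderivWithin_univ] at h
  exact h.injective

lemma contMDiffOn_chartSymmDeriv (x : M) (u : E) :
    ContMDiffOn 𝓘(ℝ, E) 𝓘(ℝ, E).tangent ∞
      (fun y => (⟨(extChartAt 𝓘(ℝ, E) x).symm y, chartSymmDeriv x y u⟩ : TangentBundle 𝓘(ℝ, E) M))
      (extChartAt 𝓘(ℝ, E) x).target := by
  have ho := isOpen_extChartAt_target (I := 𝓘(ℝ, E)) x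
  have h1 := (contMDiffOn_extChartAt_symm (I := 𝓘(ℝ, E)) (n := ∞) x).contMDiffOn_tangentMapWithin
    (m := ∞) (by simp) ho.uniqueMDiffOn
  have h2 : ContMDiff 𝓘(ℝ, E) 𝓘(ℝ, E).tangent ∞
      (fun y : E => (⟨y, u⟩ : TangentBundle 𝓘(ℝ, E) E)) := fun y =>
    contMDiffWithinAt_univ.1 (contMDiffWithinAt_vectorSpace_iff_contDiffWithinAt.2
      contDiffWithinAt_const)
  refine (h1.comp h2.contMDiffOn fun y hy => hy).congr fun y hy => ?_
  simp only [Function.comp, tangentMapWithin, chartSymmDeriv]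
  rw [mfderivWithin_of_isOpen ho hy]
  rfl

variable [RiemannianBundle (fun x : M => TangentSpace 𝓘(ℝ, E) x)]

lemma chartMetric_apply (x : M) (y u v : E) :
    chartMetric x y u v = inner ℝ (chartSymmDeriv x y u) (chartSymmDeriv x y v) := rfl

lemma chartMetric_self (x : M) (u v : TangentSpace 𝓘(ℝ, E) x) :
    chartMetric x (extChartAt 𝓘(ℝ, E) x x) u v = inner ℝ u v := by
  -- The point `φ⁻¹ (φ x)` is only propositionally equal to `x`, so the base point is generalised
  -- before substitution.
  have key : ∀ (p : M) (hp : p = x) (L : E →L[ℝ] TangentSpace 𝓘(ℝ, E) p)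
      (hL : L = ContinuousLinearMap.id ℝ E), inner ℝ (L u) (L v) = inner ℝ u v := by
    rintro p rfl L rfl
    rfl
  exact key _ (extChartAt_to_inv x) _ (chartSymmDeriv_self x)

lemma christoffel_eq (x : M) (y u v : E) :
    christoffel x y u v = christoffelMap (chartMetric x) y u v := by
  rfl

lemma chartCurvature_eq (x : M) (y u v w : E) :
    chartCurvature x y u v w = flatCurvature (chartMetric x) y u v w := by
  rfl

lemma chartDeriv_apply (x : M) (u : TangentSpace 𝓘(ℝ, E) x) : chartDeriv x u = u :=
  congrArg (fun L : E →L[ℝ] E => L u) (chartDeriv_eq_id x)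

lemma chartDeriv_inverse_apply (x : M) (u : E) : (chartDeriv x).inverse u = u :=
  congrArg (fun L : E →L[ℝ] E => L u) ((congrArg (fun L : E →L[ℝ] E => L.inverse)
    (chartDeriv_eq_id x)).trans ContinuousLinearMap.inverse_id)

lemma curvature_eq (x : M) (u v w : TangentSpace 𝓘(ℝ, E) x) :
    curvature x u v w = flatCurvature (chartMetric x) (extChartAt 𝓘(ℝ, E) x x) u v w := by
  have key : ∀ a b c : E, a = u → b = v → c = w →
      chartCurvature x (extChartAt 𝓘(ℝ, E) x x) a b c
        = flatCurvature (chartMetric x) (extChartAt 𝓘(ℝ, E) x x) u v w := by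
    rintro _ _ _ rfl rfl rfl
    exact chartCurvature_eq x _ _ _ _
  exact (chartDeriv_inverse_apply x _).trans
    (key _ _ _ (chartDeriv_apply x u) (chartDeriv_apply x v) (chartDeriv_apply x w))

variable [IsContMDiffRiemannianBundle 𝓘(ℝ, E) ∞ E (fun x : M => TangentSpace 𝓘(ℝ, E) x)]

/-- In finite dimension smoothness may be tested on fixed vectors, whose images under `dφ⁻¹` are
smooth vector fields. -/
lemma contDiffOn_chartMetric (x : M) :
    ContDiffOn ℝ ∞ (chartMetric x) (extChartAt 𝓘(ℝ, E) x).target := by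
  refine contDiffOn_clm_apply.2 fun u => contDiffOn_clm_apply.2 fun v => ?_
  exact contMDiffOn_iff_contDiffOn.1
    (ContMDiffOn.inner_bundle (F := E) (E := fun x : M => TangentSpace 𝓘(ℝ, E) x)
      (contMDiffOn_chartSymmDeriv x u) (contMDiffOn_chartSymmDeriv x v))

/-- The metric in a chart is a smooth field of nondegenerate symmetric bilinear forms. -/
lemma isMetricNear_chartMetric (x : M) {y : E} (hy : y ∈ (extChartAt 𝓘(ℝ, E) x).target) :
    IsMetricNear (chartMetric x) y where
  eventually_contDiffAt := by
    have ho := isOpen_extChartAt_target (I := 𝓘(ℝ, E)) x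
    filter_upwards [ho.mem_nhds hy] with z hz
    exact (contDiffOn_chartMetric x).contDiffAt (ho.mem_nhds hz)
  symm := Filter.Eventually.of_forall fun z u v => by
    rw [chartMetric_apply, chartMetric_apply, real_inner_comm]
  isInvertible := by
    have ho := isOpen_extChartAt_target (I := 𝓘(ℝ, E)) x
    filter_upwards [ho.mem_nhds hy] with z hz
    refine isInvertible_of_injective _ ((injective_iff_map_eq_zero _).2 fun u hu => ?_)
    have h1 : chartMetric x z u u = 0 := by rw [hu]; rfl
    rw [chartMetric_apply, inner_self_eq_zero] at h1
    exact chartSymmDeriv_injective x hz (h1.trans (map_zero _).symm)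

end Charts

/-! ### Isometric immersions in charts -/

section IsometricImmersion

variable {E : Type*} [NormedAddCommGroup E] [NormedSpace ℝ E] [FiniteDimensional ℝ E]
  {M : Type*} [TopologicalSpace M] [ChartedSpace E M] [IsManifold 𝓘(ℝ, E) ∞ M]
  [RiemannianBundle (fun x : M => TangentSpace 𝓘(ℝ, E) x)]
  [IsContMDiffRiemannianBundle 𝓘(ℝ, E) ∞ E (fun x : M => TangentSpace 𝓘(ℝ, E) x)]
  {E' : Type*} [NormedAddCommGroup E'] [NormedSpace ℝ E'] [FiniteDimensional ℝ E']
  {M' : Type*} [TopologicalSpace M'] [ChartedSpace E' M'] [IsManifold 𝓘(ℝ, E') ∞ M']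
  [RiemannianBundle (fun x : M' => TangentSpace 𝓘(ℝ, E') x)]
  [IsContMDiffRiemannianBundle 𝓘(ℝ, E') ∞ E' (fun x : M' => TangentSpace 𝓘(ℝ, E') x)]
  {f : M → M'}


lemma writtenInExtChartAt_self (f : M → M') (x : M) :
    writtenInExtChartAt 𝓘(ℝ, E) 𝓘(ℝ, E') x f (extChartAt 𝓘(ℝ, E) x x)
      = extChartAt 𝓘(ℝ, E') (f x) (f x) := by
  simp [writtenInExtChartAt]

namespace IsIsometricImmersion

lemma fderiv_writtenInExtChartAt (hf : IsIsometricImmersion E E' f) (x : M) :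
    fderiv ℝ (writtenInExtChartAt 𝓘(ℝ, E) 𝓘(ℝ, E') x f) (extChartAt 𝓘(ℝ, E) x x)
      = mfderiv 𝓘(ℝ, E) 𝓘(ℝ, E') f x := by
  have key : ∀ L : E →L[ℝ] E', HasFDerivWithinAt (writtenInExtChartAt 𝓘(ℝ, E) 𝓘(ℝ, E') x f) L
      (Set.range 𝓘(ℝ, E)) (extChartAt 𝓘(ℝ, E) x x) →
      fderiv ℝ (writtenInExtChartAt 𝓘(ℝ, E) 𝓘(ℝ, E') x f) (extChartAt 𝓘(ℝ, E) x x) = L := by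
    intro L h
    rw [ModelWithCorners.range_eq_univ, hasFDerivWithinAt_univ] at h
    exact h.fderiv
  exact key _ ((hf.contMDiff x).mdifferentiableAt (by simp)).hasMFDerivAt.2

/-- Points near `x` lie in the chart domain at `x` and are mapped into the chart domain at `f x`. -/
lemma eventually_mem (hf : IsIsometricImmersion E E' f) (x : M) :
    ∀ᶠ y in 𝓝 (extChartAt 𝓘(ℝ, E) x x), y ∈ (extChartAt 𝓘(ℝ, E) x).target ∧
      f ((extChartAt 𝓘(ℝ, E) x).symm y) ∈ (extChartAt 𝓘(ℝ, E') (f x)).source := by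
  refine Filter.Eventually.and (extChartAt_target_mem_nhds (I := 𝓘(ℝ, E)) x) ?_
  have hc : ContinuousAt (fun y => f ((extChartAt 𝓘(ℝ, E) x).symm y))
      (extChartAt 𝓘(ℝ, E) x x) :=
    hf.contMDiff.continuous.continuousAt.comp (continuousAt_extChartAt_symm x)
  apply hc.eventually
  simpa using extChartAt_source_mem_nhds (I := 𝓘(ℝ, E')) (f x)

lemma contDiffAt_writtenInExtChartAt (hf : IsIsometricImmersion E E' f) (x : M) {y : E}
    (hy : y ∈ (extChartAt 𝓘(ℝ, E) x).target)
    (hfy : f ((extChartAt 𝓘(ℝ, E) x).symm y) ∈ (extChartAt 𝓘(ℝ, E') (f x)).source) :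
    ContDiffAt ℝ ∞ (writtenInExtChartAt 𝓘(ℝ, E) 𝓘(ℝ, E') x f) y := by
  rw [← contMDiffAt_iff_contDiffAt]
  have h1 : ContMDiffAt 𝓘(ℝ, E) 𝓘(ℝ, E) ∞ (extChartAt 𝓘(ℝ, E) x).symm y :=
    (contMDiffOn_extChartAt_symm x).contMDiffAt
      ((isOpen_extChartAt_target (I := 𝓘(ℝ, E)) x).mem_nhds hy)
  have h2 : ContMDiffAt 𝓘(ℝ, E') 𝓘(ℝ, E') ∞ (extChartAt 𝓘(ℝ, E') (f x))
      (f ((extChartAt 𝓘(ℝ, E) x).symm y)) :=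
    contMDiffAt_extChartAt' (by simpa using hfy)
  exact h2.comp y ((hf.contMDiff _).comp y h1)

/-- Differentiate `φ'⁻¹ ∘ F = f ∘ φ⁻¹`, valid near `y`. The two sides lie in tangent spaces at
propositionally equal points, hence the comparison in `E'`. -/
lemma chartSymmDeriv_comp (hf : IsIsometricImmersion E E' f) (x : M) {y : E}
    (hy : y ∈ (extChartAt 𝓘(ℝ, E) x).target)
    (hfy : f ((extChartAt 𝓘(ℝ, E) x).symm y) ∈ (extChartAt 𝓘(ℝ, E') (f x)).source) (u : E) :
    (chartSymmDeriv (f x) (writtenInExtChartAt 𝓘(ℝ, E) 𝓘(ℝ, E') x f y)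
      (fderiv ℝ (writtenInExtChartAt 𝓘(ℝ, E) 𝓘(ℝ, E') x f) y u) : E')
      = mfderiv 𝓘(ℝ, E) 𝓘(ℝ, E') f ((extChartAt 𝓘(ℝ, E) x).symm y) (chartSymmDeriv x y u) := by
  have ho := isOpen_extChartAt_target (I := 𝓘(ℝ, E)) x
  have ho' := isOpen_extChartAt_target (I := 𝓘(ℝ, E')) (f x)
  set F := writtenInExtChartAt 𝓘(ℝ, E) 𝓘(ℝ, E') x f with hF
  have h1 : ContMDiffAt 𝓘(ℝ, E) 𝓘(ℝ, E) ∞ (extChartAt 𝓘(ℝ, E) x).symm y :=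
    (contMDiffOn_extChartAt_symm x).contMDiffAt (ho.mem_nhds hy)
  have hFy : F y ∈ (extChartAt 𝓘(ℝ, E') (f x)).target :=
    (extChartAt 𝓘(ℝ, E') (f x)).map_source hfy
  have h2 : ContMDiffAt 𝓘(ℝ, E') 𝓘(ℝ, E') ∞ (extChartAt 𝓘(ℝ, E') (f x)).symm (F y) :=
    (contMDiffOn_extChartAt_symm (f x)).contMDiffAt (ho'.mem_nhds hFy)
  have h3 : MDifferentiableAt 𝓘(ℝ, E) 𝓘(ℝ, E') F y :=
    ((hf.contDiffAt_writtenInExtChartAt x hy hfy).differentiableAt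
      (by simp)).mdifferentiableAt
  have e1 := mfderiv_comp y (h2.mdifferentiableAt (by simp)) h3
  have e2 := mfderiv_comp y ((hf.contMDiff _).mdifferentiableAt (by simp))
    (h1.mdifferentiableAt (by simp))
  have heq : (extChartAt 𝓘(ℝ, E') (f x)).symm ∘ F =ᶠ[𝓝 y] f ∘ (extChartAt 𝓘(ℝ, E) x).symm := by
    have hc : ContinuousAt (f ∘ (extChartAt 𝓘(ℝ, E) x).symm) y :=
      hf.contMDiff.continuous.continuousAt.comp h1.continuousAt
    have hs := hc.eventually ((isOpen_extChartAt_source (I := 𝓘(ℝ, E')) (f x)).mem_nhds hfy)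
    filter_upwards [hs] with z hz
    exact (extChartAt 𝓘(ℝ, E') (f x)).left_inv hz
  have e3 := heq.mfderiv_eq (I := 𝓘(ℝ, E)) (I' := 𝓘(ℝ, E'))
  have e4 := congrArg (fun L : E →L[ℝ] E' => L u) (e1.symm.trans (e3.trans e2))
  rw [mfderiv_eq_fderiv] at e4
  exact e4

/-- In charts, an isometric immersion is an isometric immersion. -/
lemma isIsometricNear (hf : IsIsometricImmersion E E' f) (x : M) :
    IsIsometricNear (chartMetric x) (chartMetric (f x))
      (writtenInExtChartAt 𝓘(ℝ, E) 𝓘(ℝ, E') x f) (extChartAt 𝓘(ℝ, E) x x) where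
  left := isMetricNear_chartMetric x (mem_extChartAt_target x)
  right := by
    rw [writtenInExtChartAt_self]
    exact isMetricNear_chartMetric (f x) (mem_extChartAt_target (f x))
  eventually_contDiffAt := by
    filter_upwards [hf.eventually_mem x] with y hy
    exact hf.contDiffAt_writtenInExtChartAt x hy.1 hy.2
  isometric := by
    filter_upwards [hf.eventually_mem x] with y hy u v
    rw [chartMetric_apply, chartMetric_apply, ← hf.inner_mfderiv]
    have key : ∀ (p q : M') (_ : p = q) (a b : TangentSpace 𝓘(ℝ, E') p)
        (c d : TangentSpace 𝓘(ℝ, E') q) (_ : (a : E') = c) (_ : (b : E') = d),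
        inner ℝ c d = inner ℝ a b := by
      rintro p q rfl a b c d h1 h2
      exact (congrArg₂ (fun s t : TangentSpace 𝓘(ℝ, E') p => inner ℝ s t) h1 h2).symm
    exact key _ _ ((extChartAt 𝓘(ℝ, E') (f x)).left_inv hy.2) _ _ _ _
      (hf.chartSymmDeriv_comp x hy.1 hy.2 u) (hf.chartSymmDeriv_comp x hy.1 hy.2 v)

end IsIsometricImmersion

end IsometricImmersion

/-! ### Traces and orthonormal bases -/

section LinearAlgebra

/-- The trace of a vector-valued bilinear map does not depend on the orthonormal basis. -/
lemma sum_orthonormalBasis_eq {V W ι κ : Type*} [NormedAddCommGroup V] [InnerProductSpace ℝ V]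
    [AddCommGroup W] [Module ℝ W] [Fintype ι] [Fintype κ] (B : V →ₗ[ℝ] V →ₗ[ℝ] W)
    (b : OrthonormalBasis ι ℝ V) (c : OrthonormalBasis κ ℝ V) :
    ∑ i, B (b i) (b i) = ∑ j, B (c j) (c j) := by
  classical
  have h : ∀ i, B (b i) (b i)
      = ∑ j, ∑ k, (inner ℝ (c j) (b i) * inner ℝ (b i) (c k) : ℝ) • B (c j) (c k) := by
    intro i
    conv_lhs => rw [← c.sum_repr' (b i)]
    simp only [map_sum, map_smul, LinearMap.sum_apply, LinearMap.smul_apply, Finset.smul_sum,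
      smul_smul]
    rw [Finset.sum_comm]
    refine Finset.sum_congr rfl fun j _ => Finset.sum_congr rfl fun k _ => ?_
    rw [real_inner_comm (c k), mul_comm]
  -- With the sum over `i` innermost, Parseval turns the coefficients into `⟨c j, c k⟩`.
  calc ∑ i, B (b i) (b i)
      = ∑ j, ∑ k, (∑ i, inner ℝ (c j) (b i) * inner ℝ (b i) (c k) : ℝ) • B (c j) (c k) := by
        simp only [h, Finset.sum_smul]
        rw [Finset.sum_comm]
        exact Finset.sum_congr rfl fun j _ => Finset.sum_comm
    _ = ∑ j, B (c j) (c j) := by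
        refine Finset.sum_congr rfl fun j _ => ?_
        simp [OrthonormalBasis.sum_inner_mul_inner, orthonormal_iff_ite.1 c.orthonormal]

/-- A unit vector and an orthonormal basis of a complementary orthogonal subspace form an
orthonormal basis. -/
lemma exists_orthonormalBasis_cons {V : Type*} [NormedAddCommGroup V] [InnerProductSpace ℝ V]
    {q : ℕ} {n : V} (hn : ‖n‖ = 1) {K : Submodule ℝ V} (hK : ∀ v ∈ K, inner ℝ n v = 0)
    (htop : Submodule.span ℝ {n} ⊔ K = ⊤) (e : OrthonormalBasis (Fin q) ℝ K) :
    ∃ c : OrthonormalBasis (Fin (q + 1)) ℝ V, c 0 = n ∧ ∀ i : Fin q, c i.succ = e i := by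
  have ho : Orthonormal ℝ (Fin.cons n (fun i => (e i : V)) : Fin (q + 1) → V) := by
    refine ⟨fun i => ?_, fun i j hij => ?_⟩
    · refine Fin.cases ?_ (fun i => ?_) i
      · simpa using hn
      · exact e.norm_eq_one i
    · induction i using Fin.cases with
      | zero =>
        induction j using Fin.cases with
        | zero => exact absurd rfl hij
        | succ j => simpa using hK _ (e j).2
      | succ i =>
        induction j using Fin.cases with
        | zero => simpa [real_inner_comm] using hK _ (e i).2
        | succ j =>
          have := e.orthonormal.2 (i := i) (j := j) (fun h => hij (by rw [h]))
          simpa using this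
  have hs : ⊤ ≤ Submodule.span ℝ
      (Set.range (Fin.cons n (fun i => (e i : V)) : Fin (q + 1) → V)) := by
    rw [← htop, sup_le_iff]
    constructor
    · exact Submodule.span_mono (by rintro _ rfl; exact ⟨0, rfl⟩)
    · intro v hv
      have h1 : v = ∑ i, (inner ℝ (e i) (⟨v, hv⟩ : K) : ℝ) • (e i : V) := by
        have := congrArg (Subtype.val) (e.sum_repr' (⟨v, hv⟩ : K))
        simpa using this.symm
      rw [h1]
      exact Submodule.sum_mem _ fun i _ => Submodule.smul_mem _ _
        (Submodule.subset_span ⟨i.succ, by simp⟩)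
  exact ⟨OrthonormalBasis.mk ho hs, by simp, fun i => by simp⟩

end LinearAlgebra

/-! ### Curvature symmetries and the Gauss equation on manifolds -/

section IsometricImmersion

variable {E : Type*} [NormedAddCommGroup E] [NormedSpace ℝ E] [FiniteDimensional ℝ E]
  {M : Type*} [TopologicalSpace M] [ChartedSpace E M] [IsManifold 𝓘(ℝ, E) ∞ M]
  [RiemannianBundle (fun x : M => TangentSpace 𝓘(ℝ, E) x)]
  [IsContMDiffRiemannianBundle 𝓘(ℝ, E) ∞ E (fun x : M => TangentSpace 𝓘(ℝ, E) x)]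
  {E' : Type*} [NormedAddCommGroup E'] [NormedSpace ℝ E'] [FiniteDimensional ℝ E']
  {M' : Type*} [TopologicalSpace M'] [ChartedSpace E' M'] [IsManifold 𝓘(ℝ, E') ∞ M']
  [RiemannianBundle (fun x : M' => TangentSpace 𝓘(ℝ, E') x)]
  [IsContMDiffRiemannianBundle 𝓘(ℝ, E') ∞ E' (fun x : M' => TangentSpace 𝓘(ℝ, E') x)]
  {f : M → M'}

lemma inner_curvature_skew (x : M) (u v w z : TangentSpace 𝓘(ℝ, E) x) :
    (inner ℝ (curvature x u v w) z : ℝ) = - inner ℝ (curvature x u v z) w := by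
  have h := (isMetricNear_chartMetric x
    (mem_extChartAt_target (I := 𝓘(ℝ, E)) x)).apply_flatCurvature_skew u v w z
  rw [curvature_eq, curvature_eq]
  exact ((chartMetric_self x _ z).symm.trans h).trans (congrArg Neg.neg (chartMetric_self x _ w))

lemma curvature_antisymm (x : M) (u v w : TangentSpace 𝓘(ℝ, E) x) :
    curvature x u v w = - curvature x v u w := by
  rw [curvature_eq, curvature_eq]
  exact flatCurvature_antisymm _ _ u v w

/-- The two skew-symmetries suffice; the Bianchi identity is not needed. -/
lemma sectionalCurvature_comm (x : M) (u v : TangentSpace 𝓘(ℝ, E) x) :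
    sectionalCurvature x u v = sectionalCurvature x v u := by
  rw [sectionalCurvature, sectionalCurvature, inner_curvature_skew, curvature_antisymm,
    inner_neg_left, neg_neg]

/-- The bilinear form `(w, z) ↦ g (R (w, u) v, z)`. -/
lemma exists_curvature_bilinear (x : M) (u v : TangentSpace 𝓘(ℝ, E) x) :
    ∃ B : TangentSpace 𝓘(ℝ, E) x →ₗ[ℝ] TangentSpace 𝓘(ℝ, E) x →ₗ[ℝ] ℝ,
      ∀ w z, B w z = inner ℝ (curvature x w u v) z := by
  have hG := isMetricNear_chartMetric x (mem_extChartAt_target (I := 𝓘(ℝ, E)) x)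
  have hadd : ∀ w w' : TangentSpace 𝓘(ℝ, E) x,
      curvature x (w + w') u v = curvature x w u v + curvature x w' u v := by
    intro w w'
    rw [curvature_eq, curvature_eq, curvature_eq]
    have key : ∀ a a' b c : E, flatCurvature (chartMetric x) (extChartAt 𝓘(ℝ, E) x x) (a + a') b c
      = flatCurvature (chartMetric x) (extChartAt 𝓘(ℝ, E) x x) a b c
        + flatCurvature (chartMetric x) (extChartAt 𝓘(ℝ, E) x x) a' b c := by
      intro a a' b c
      simp only [flatCurvature, hG.fderiv_christoffelMap_apply]
      simp only [map_add, _root_.add_apply]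
      abel
    exact key w w' u v
  have hsmul : ∀ (r : ℝ) (w : TangentSpace 𝓘(ℝ, E) x),
      curvature x (r • w) u v = r • curvature x w u v := by
    intro r w
    rw [curvature_eq, curvature_eq]
    have key : ∀ a b c : E, flatCurvature (chartMetric x) (extChartAt 𝓘(ℝ, E) x x) (r • a) b c
      = r • flatCurvature (chartMetric x) (extChartAt 𝓘(ℝ, E) x x) a b c := by
      intro a b c
      simp only [flatCurvature, hG.fderiv_christoffelMap_apply]
      simp only [map_smul, _root_.smul_apply, smul_add, smul_sub]
    exact key w u v
  exact ⟨LinearMap.mk₂ ℝ (fun w z => inner ℝ (curvature x w u v) z)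
    (fun w w' z => by rw [hadd, inner_add_left])
    (fun r w z => by rw [hsmul, real_inner_smul_left]; rfl)
    (fun w z z' => inner_add_right _ _ _)
    (fun r w z => by rw [real_inner_smul_right]; rfl), fun w z => rfl⟩

/-- The Ricci tensor computed in any orthonormal basis. -/
lemma ricci_eq_sum {ι : Type*} [Fintype ι] (x : M) (u v : TangentSpace 𝓘(ℝ, E) x)
    (b : OrthonormalBasis ι ℝ (TangentSpace 𝓘(ℝ, E) x)) :
    ricci x u v = ∑ i, inner ℝ (curvature x (b i) u v) (b i) := by
  obtain ⟨B, hB⟩ := exists_curvature_bilinear x u v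
  simp only [ricci, ← hB]
  exact sum_orthonormalBasis_eq B _ b

namespace IsIsometricImmersion

lemma ambientCovDeriv_eq (hf : IsIsometricImmersion E E' f) (x : M)
    (u v : TangentSpace 𝓘(ℝ, E) x) :
    ambientCovDeriv E E' f x u v = flatCovDeriv (chartMetric (f x))
      (writtenInExtChartAt 𝓘(ℝ, E) 𝓘(ℝ, E') x f) (extChartAt 𝓘(ℝ, E) x x) u v := by
  have h := hf.isIsometricNear x
  have hd := hf.fderiv_writtenInExtChartAt x
  have hp := writtenInExtChartAt_self (E := E) (E' := E') f x
  rw [ambientCovDeriv]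
  generalize writtenInExtChartAt 𝓘(ℝ, E) 𝓘(ℝ, E') x f = F at h hd hp
  have key : ∀ (a b a' b' : E) (c d : E'), a = a' → b = b' →
      c = fderiv ℝ F (extChartAt 𝓘(ℝ, E) x x) a' → d = fderiv ℝ F (extChartAt 𝓘(ℝ, E) x x) b' →
      fderiv ℝ (fun y => fderiv ℝ F y b) (extChartAt 𝓘(ℝ, E) x x) a
        + christoffel (f x) (extChartAt 𝓘(ℝ, E') (f x) (f x)) c d
      = flatCovDeriv (chartMetric (f x)) F (extChartAt 𝓘(ℝ, E) x x) a' b' := by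
    rintro a b _ _ _ _ rfl rfl rfl rfl
    rw [← hp, flatCovDeriv, (h.hasFDerivAt_fderiv.clm_apply (hasFDerivAt_const _ _)).fderiv,
      christoffel_eq]
    simp
  have hd' : ∀ w : TangentSpace 𝓘(ℝ, E) x,
      chartDeriv (f x) (mfderiv 𝓘(ℝ, E) 𝓘(ℝ, E') f x w)
        = fderiv ℝ F (extChartAt 𝓘(ℝ, E) x x) w := fun w =>
    (chartDeriv_apply (f x) _).trans (congrArg (fun L : E →L[ℝ] E' => L w) hd.symm)
  exact (chartDeriv_inverse_apply (f x) _).trans (key _ _ _ _ _ _ (chartDeriv_apply x u)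
    (chartDeriv_apply x v) (hd' u) (hd' v))

/-- The Christoffel symbol at the centre of the preferred chart, as a tangent vector. -/
def christoffelVec (x : M) (u v : TangentSpace 𝓘(ℝ, E) x) : TangentSpace 𝓘(ℝ, E) x :=
  christoffelMap (chartMetric x) (extChartAt 𝓘(ℝ, E) x x) u v

lemma inner_sub_christoffelVec (hf : IsIsometricImmersion E E' f) (x : M)
    (u v w : TangentSpace 𝓘(ℝ, E) x) :
    (inner ℝ (ambientCovDeriv E E' f x u v
      - mfderiv 𝓘(ℝ, E) 𝓘(ℝ, E') f x (christoffelVec x u v))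
      (mfderiv 𝓘(ℝ, E) 𝓘(ℝ, E') f x w) : ℝ) = 0 := by
  rw [← chartMetric_self, hf.ambientCovDeriv_eq]
  have h := (hf.isIsometricNear x).apply_flatCovDeriv_sub u v w
  rw [hf.fderiv_writtenInExtChartAt x, writtenInExtChartAt_self] at h
  exact h

/-- The subtracted vector is tangent and the difference is normal, which characterises the
orthogonal projection. -/
lemma secondFundamentalForm_eq (hf : IsIsometricImmersion E E' f) (x : M)
    (u v : TangentSpace 𝓘(ℝ, E) x) :
    secondFundamentalForm E E' f x u v = ambientCovDeriv E E' f x u v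
      - mfderiv 𝓘(ℝ, E) 𝓘(ℝ, E') f x (christoffelVec x u v) := by
  refine Submodule.eq_starProjection_of_mem_orthogonal ?_ ?_
  · rw [Submodule.mem_orthogonal']
    rintro _ ⟨w, rfl⟩
    exact hf.inner_sub_christoffelVec x u v w
  · rw [sub_sub_cancel]
    exact Submodule.le_orthogonal_orthogonal _ ⟨christoffelVec x u v, rfl⟩

lemma inner_secondFundamentalForm_mfderiv (hf : IsIsometricImmersion E E' f) (x : M)
    (u v w : TangentSpace 𝓘(ℝ, E) x) :
    (inner ℝ (secondFundamentalForm E E' f x u v)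
      (mfderiv 𝓘(ℝ, E) 𝓘(ℝ, E') f x w) : ℝ) = 0 := by
  rw [hf.secondFundamentalForm_eq]
  exact hf.inner_sub_christoffelVec x u v w

/-- Already the full ambient derivative is symmetric: `D²F` is, and the ambient connection is
torsion-free. -/
lemma secondFundamentalForm_comm (hf : IsIsometricImmersion E E' f) (x : M)
    (u v : TangentSpace 𝓘(ℝ, E) x) :
    secondFundamentalForm E E' f x u v = secondFundamentalForm E E' f x v u := by
  have h : ambientCovDeriv E E' f x u v = ambientCovDeriv E E' f x v u := by
    rw [hf.ambientCovDeriv_eq, hf.ambientCovDeriv_eq]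
    exact (hf.isIsometricNear x).flatCovDeriv_symm u v
  rw [secondFundamentalForm, secondFundamentalForm, h]

/-- The second fundamental form is bilinear. -/
lemma exists_secondFundamentalForm_bilinear (hf : IsIsometricImmersion E E' f) (x : M) :
    ∃ B : TangentSpace 𝓘(ℝ, E) x →ₗ[ℝ] TangentSpace 𝓘(ℝ, E) x →ₗ[ℝ] TangentSpace 𝓘(ℝ, E') (f x),
      ∀ u v, B u v = secondFundamentalForm E E' f x u v := by
  have hadd : ∀ u u' v, secondFundamentalForm E E' f x (u + u') v
      = secondFundamentalForm E E' f x u v + secondFundamentalForm E E' f x u' v := by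
    intro u u' v
    have h : ambientCovDeriv E E' f x (u + u') v
        = ambientCovDeriv E E' f x u v + ambientCovDeriv E E' f x u' v := by
      rw [hf.ambientCovDeriv_eq, hf.ambientCovDeriv_eq, hf.ambientCovDeriv_eq]
      have key : ∀ (G : E' → E' →L[ℝ] E' →L[ℝ] ℝ) (F : E → E') (y a a' b : E),
          flatCovDeriv G F y (a + a') b = flatCovDeriv G F y a b + flatCovDeriv G F y a' b := by
        intro G F y a a' b
        simp only [flatCovDeriv, map_add, _root_.add_apply]
        abel
      exact key _ _ _ u u' v
    simp only [secondFundamentalForm, h, map_add]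
  have hsmul : ∀ (r : ℝ) u v, secondFundamentalForm E E' f x (r • u) v
      = r • secondFundamentalForm E E' f x u v := by
    intro r u v
    have h : ambientCovDeriv E E' f x (r • u) v = r • ambientCovDeriv E E' f x u v := by
      rw [hf.ambientCovDeriv_eq, hf.ambientCovDeriv_eq]
      have key : ∀ (G : E' → E' →L[ℝ] E' →L[ℝ] ℝ) (F : E → E') (y a b : E),
          flatCovDeriv G F y (r • a) b = r • flatCovDeriv G F y a b := by
        intro G F y a b
        simp only [flatCovDeriv, map_smul, _root_.smul_apply, smul_add]
      exact key _ _ _ u v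
    simp only [secondFundamentalForm, h, map_smul]
  refine ⟨LinearMap.mk₂ ℝ (fun u v => secondFundamentalForm E E' f x u v) hadd hsmul ?_ ?_,
    fun u v => rfl⟩
  · intro u v v'
    rw [hf.secondFundamentalForm_comm x u, hadd, hf.secondFundamentalForm_comm x u v,
      hf.secondFundamentalForm_comm x u v']
  · intro r u v
    rw [hf.secondFundamentalForm_comm x u, hsmul, hf.secondFundamentalForm_comm x u v]

/-- The **Gauss equation** of an isometric immersion. -/
lemma gauss (hf : IsIsometricImmersion E E' f) (x : M) (u v w z : TangentSpace 𝓘(ℝ, E) x) :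
    (inner ℝ (curvature x u v w) z : ℝ)
      = inner ℝ (curvature (f x) (mfderiv 𝓘(ℝ, E) 𝓘(ℝ, E') f x u)
            (mfderiv 𝓘(ℝ, E) 𝓘(ℝ, E') f x v) (mfderiv 𝓘(ℝ, E) 𝓘(ℝ, E') f x w))
          (mfderiv 𝓘(ℝ, E) 𝓘(ℝ, E') f x z)
        + inner ℝ (secondFundamentalForm E E' f x v w) (secondFundamentalForm E E' f x u z)
        - inner ℝ (secondFundamentalForm E E' f x u w) (secondFundamentalForm E E' f x v z) := by
  have h := (hf.isIsometricNear x).gauss u v w z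
  rw [hf.fderiv_writtenInExtChartAt x, writtenInExtChartAt_self] at h
  have h1 : (inner ℝ (curvature x u v w) z : ℝ)
      = inner ℝ (curvature (f x) (mfderiv 𝓘(ℝ, E) 𝓘(ℝ, E') f x u)
            (mfderiv 𝓘(ℝ, E) 𝓘(ℝ, E') f x v) (mfderiv 𝓘(ℝ, E) 𝓘(ℝ, E') f x w))
          (mfderiv 𝓘(ℝ, E) 𝓘(ℝ, E') f x z)
        + inner ℝ (ambientCovDeriv E E' f x v w) (ambientCovDeriv E E' f x u z)
        - inner ℝ (ambientCovDeriv E E' f x u w) (ambientCovDeriv E E' f x v z)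
        - inner ℝ (christoffelVec x v w) (christoffelVec x u z)
        + inner ℝ (christoffelVec x u w) (christoffelVec x v z) := by
    simp only [curvature_eq, hf.ambientCovDeriv_eq]
    exact (chartMetric_self x _ z).symm.trans (h.trans
      (congrArg₂ (· + ·) (congrArg₂ (· - ·) (congrArg₂ (· - ·) (congrArg₂ (· + ·)
        (chartMetric_self (f x) _ _) (chartMetric_self (f x) _ _)) (chartMetric_self (f x) _ _))
        (chartMetric_self x _ _)) (chartMetric_self x _ _)))
  -- Normal and tangential parts are orthogonal, and the tangential products are exactly the
  -- Christoffel terms to be cancelled in `h1`.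
  have h2 : ∀ a b c d : TangentSpace 𝓘(ℝ, E) x,
      (inner ℝ (ambientCovDeriv E E' f x a b) (ambientCovDeriv E E' f x c d) : ℝ)
        = inner ℝ (secondFundamentalForm E E' f x a b) (secondFundamentalForm E E' f x c d)
          + inner ℝ (christoffelVec x a b) (christoffelVec x c d) := by
    intro a b c d
    have e : ∀ a b, ambientCovDeriv E E' f x a b = secondFundamentalForm E E' f x a b
        + mfderiv 𝓘(ℝ, E) 𝓘(ℝ, E') f x (christoffelVec x a b) := fun a b => by
      rw [hf.secondFundamentalForm_eq, sub_add_cancel]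
    rw [e a b, e c d, inner_add_left, inner_add_right, inner_add_right, hf.inner_mfderiv,
      hf.inner_secondFundamentalForm_mfderiv,
      real_inner_comm (secondFundamentalForm E E' f x c d) (mfderiv 𝓘(ℝ, E) 𝓘(ℝ, E') f x _),
      hf.inner_secondFundamentalForm_mfderiv]
    ring
  rw [h1, h2, h2]
  ring

end IsIsometricImmersion

end IsometricImmersion


/-! ### The Ricci identity and its defect term -/

section RicciEstimate

variable {E : Type*} [NormedAddCommGroup E] [NormedSpace ℝ E] [FiniteDimensional ℝ E]
  {M : Type*} [TopologicalSpace M] [ChartedSpace E M] [IsManifold 𝓘(ℝ, E) ∞ M]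
  [RiemannianBundle (fun x : M => TangentSpace 𝓘(ℝ, E) x)]
  [IsContMDiffRiemannianBundle 𝓘(ℝ, E) ∞ E (fun x : M => TangentSpace 𝓘(ℝ, E) x)]
  {E' : Type*} [NormedAddCommGroup E'] [NormedSpace ℝ E'] [FiniteDimensional ℝ E']
  {M' : Type*} [TopologicalSpace M'] [ChartedSpace E' M'] [IsManifold 𝓘(ℝ, E') ∞ M']
  [RiemannianBundle (fun x : M' => TangentSpace 𝓘(ℝ, E') x)]
  [IsContMDiffRiemannianBundle 𝓘(ℝ, E') ∞ E' (fun x : M' => TangentSpace 𝓘(ℝ, E') x)]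
  {f : M → M'}

lemma IsDistribution.finrank_eq {D : ∀ x : M, Submodule ℝ (TangentSpace 𝓘(ℝ, E) x)} {r : ℕ}
    (hD : IsDistribution D r) (x : M) : Module.finrank ℝ (D x) = r := by
  obtain ⟨U, hU, X, -, hX⟩ := hD x
  obtain ⟨h1, h2⟩ := hX x (mem_of_mem_nhds hU)
  rw [← h2, finrank_span_eq_card h1, Fintype.card_fin]

lemma qRicci_le_supQRicci {q : ℕ} (y : M') (e : Fin (q + 1) → TangentSpace 𝓘(ℝ, E') y)
    (he : Orthonormal ℝ e) : (qRicci y e : EReal) ≤ supQRicci E' M' q :=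
  (le_iSup (fun _ : Orthonormal ℝ e => (qRicci y e : EReal)) he).trans
    ((le_iSup (fun e : Fin (q + 1) → TangentSpace 𝓘(ℝ, E') y =>
      ⨆ _ : Orthonormal ℝ e, (qRicci y e : EReal)) e).trans
    (le_iSup (fun y : M' => ⨆ (e : Fin (q + 1) → TangentSpace 𝓘(ℝ, E') y)
      (_ : Orthonormal ℝ e), (qRicci y e : EReal)) y))

lemma IsIsometricImmersion.meanCurvature_eq_sum (hf : IsIsometricImmersion E E' f) {ι : Type*}
    [Fintype ι] (x : M) (b : OrthonormalBasis ι ℝ (TangentSpace 𝓘(ℝ, E) x)) :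
    meanCurvature E E' f x = ∑ i, secondFundamentalForm E E' f x (b i) (b i) := by
  obtain ⟨B, hB⟩ := hf.exists_secondFundamentalForm_bilinear x
  simp only [meanCurvature, ← hB]
  exact sum_orthonormalBasis_eq B _ b

lemma IsIsometricImmersion.meanCurvatureOn_eq_sum (hf : IsIsometricImmersion E E' f) {ι : Type*}
    [Fintype ι] (D : ∀ x : M, Submodule ℝ (TangentSpace 𝓘(ℝ, E) x)) (x : M)
    (b : OrthonormalBasis ι ℝ (D x)) :
    meanCurvatureOn E E' f D x = ∑ i, secondFundamentalForm E E' f x (b i) (b i) := by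
  obtain ⟨B, hB⟩ := hf.exists_secondFundamentalForm_bilinear x
  simp only [meanCurvatureOn, ← hB]
  exact sum_orthonormalBasis_eq (B.compl₁₂ (D x).subtype (D x).subtype) _ b

lemma meanCurvatureOn_span_singleton (hf : IsIsometricImmersion E E' f)
    (D : ∀ x : M, Submodule ℝ (TangentSpace 𝓘(ℝ, E) x)) (x : M) {n : TangentSpace 𝓘(ℝ, E) x}
    (hn : ‖n‖ = 1) (hD : D x = Submodule.span ℝ {n}) :
    meanCurvatureOn E E' f D x = secondFundamentalForm E E' f x n n := by
  have hmem : n ∈ D x := hD ▸ Submodule.mem_span_singleton_self n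
  have ho : Orthonormal ℝ (fun _ : Fin 1 => (⟨n, hmem⟩ : D x)) :=
    ⟨fun _ => hn, fun i j hij => absurd (Subsingleton.elim i j) hij⟩
  have hs : ⊤ ≤ Submodule.span ℝ (Set.range fun _ : Fin 1 => (⟨n, hmem⟩ : D x)) := by
    rintro ⟨v, hv⟩ -
    have hv' := hv
    rw [hD, Submodule.mem_span_singleton] at hv'
    obtain ⟨r, rfl⟩ := hv'
    have h : (⟨r • n, hv⟩ : D x) = r • ⟨n, hmem⟩ := rfl
    rw [h]
    exact Submodule.smul_mem _ r (Submodule.subset_span (Set.mem_range_self (0 : Fin 1)))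
  rw [hf.meanCurvatureOn_eq_sum D x (OrthonormalBasis.mk ho hs)]
  simp

/-- The Ricci curvature in the direction of a unit vector `n`, in terms of the ambient curvature
and of the second fundamental form. -/
lemma IsIsometricImmersion.ricci_eq (hf : IsIsometricImmersion E E' f) {q : ℕ}
    {D₁ D₂ : ∀ x : M, Submodule ℝ (TangentSpace 𝓘(ℝ, E) x)} (x : M) {n : TangentSpace 𝓘(ℝ, E) x}
    (hn : ‖n‖ = 1) (hD₁ : D₁ x = Submodule.span ℝ {n}) (hperp : D₁ x ⟂ D₂ x)
    (htop : D₁ x ⊔ D₂ x = ⊤) (e : OrthonormalBasis (Fin q) ℝ (D₂ x)) :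
    ricci x n n = 1 / 4 * ‖meanCurvature E E' f x‖ ^ 2
      + qRicci (f x) (Fin.cons (mfderiv 𝓘(ℝ, E) 𝓘(ℝ, E') f x n)
          (fun i => mfderiv 𝓘(ℝ, E) 𝓘(ℝ, E') f x (e i : TangentSpace 𝓘(ℝ, E) x)))
      - (1 / 4 * ‖meanCurvatureOn E E' f D₁ x - meanCurvatureOn E E' f D₂ x‖ ^ 2
        + ∑ i, ‖secondFundamentalForm E E' f x n (e i)‖ ^ 2) := by
  have hn' : ∀ v ∈ D₂ x, inner ℝ n v = 0 := fun v hv =>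
    Submodule.isOrtho_iff_inner_eq.1 hperp n (hD₁ ▸ Submodule.mem_span_singleton_self n) v hv
  obtain ⟨c, hc0, hc⟩ := exists_orthonormalBasis_cons hn hn' (hD₁ ▸ htop) e
  have hterm : ∀ i : Fin q, (inner ℝ (curvature x (e i : TangentSpace 𝓘(ℝ, E) x) n n)
      (e i : TangentSpace 𝓘(ℝ, E) x) : ℝ)
      = sectionalCurvature (f x) (mfderiv 𝓘(ℝ, E) 𝓘(ℝ, E') f x n)
          (mfderiv 𝓘(ℝ, E) 𝓘(ℝ, E') f x (e i : TangentSpace 𝓘(ℝ, E) x))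
        + inner ℝ (secondFundamentalForm E E' f x n n)
            (secondFundamentalForm E E' f x (e i) (e i))
        - ‖secondFundamentalForm E E' f x n (e i)‖ ^ 2 := by
    intro i
    -- The Ricci trace has `e i` in the first slot, whereas `qRicci` has the distinguished vector
    -- there.
    have h1 := sectionalCurvature_comm x (e i : TangentSpace 𝓘(ℝ, E) x) n
    rw [sectionalCurvature, sectionalCurvature] at h1
    rw [h1, hf.gauss, hf.secondFundamentalForm_comm x (e i : TangentSpace 𝓘(ℝ, E) x) n,
      real_inner_self_eq_norm_sq, sectionalCurvature,
      real_inner_comm (secondFundamentalForm E E' f x n n)]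
  have h0 : (inner ℝ (curvature x n n n) n : ℝ) = 0 := by
    linarith [inner_curvature_skew x n n n n]
  have hH : meanCurvature E E' f x
      = meanCurvatureOn E E' f D₁ x + meanCurvatureOn E E' f D₂ x := by
    rw [hf.meanCurvature_eq_sum x c, meanCurvatureOn_span_singleton hf D₁ x hn hD₁,
      hf.meanCurvatureOn_eq_sum D₂ x e, Fin.sum_univ_succ, hc0]
    simp only [hc]
  have hin : ∑ i, (inner ℝ (secondFundamentalForm E E' f x n n)
      (secondFundamentalForm E E' f x (e i) (e i)) : ℝ)
      = inner ℝ (meanCurvatureOn E E' f D₁ x) (meanCurvatureOn E E' f D₂ x) := by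
    rw [meanCurvatureOn_span_singleton hf D₁ x hn hD₁, hf.meanCurvatureOn_eq_sum D₂ x e, inner_sum]
  rw [ricci_eq_sum x n n c, Fin.sum_univ_succ, hc0, h0, zero_add]
  simp only [hc, hterm]
  -- Polarisation: expanding both squared norms leaves `⟨H₁, H₂⟩`.
  rw [Finset.sum_sub_distrib, Finset.sum_add_distrib, hin, hH, norm_add_sq_real, norm_sub_sq_real,
    qRicci]
  simp only [Fin.cons_zero, Fin.cons_succ]
  ring

/-- The differential of an isometric immersion preserves orthonormal families. -/
lemma IsIsometricImmersion.orthonormal_cons (hf : IsIsometricImmersion E E' f) {q : ℕ} (x : M)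
    {D : Submodule ℝ (TangentSpace 𝓘(ℝ, E) x)} {n : TangentSpace 𝓘(ℝ, E) x}
    (hn : ‖n‖ = 1) (hperp : ∀ v ∈ D, inner ℝ n v = 0)
    (htop : Submodule.span ℝ {n} ⊔ D = ⊤) (e : OrthonormalBasis (Fin q) ℝ D) :
    Orthonormal ℝ (Fin.cons (mfderiv 𝓘(ℝ, E) 𝓘(ℝ, E') f x n)
      (fun i => mfderiv 𝓘(ℝ, E) 𝓘(ℝ, E') f x (e i : TangentSpace 𝓘(ℝ, E) x)) :
      Fin (q + 1) → TangentSpace 𝓘(ℝ, E') (f x)) := by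
  obtain ⟨c, hc0, hc⟩ := exists_orthonormalBasis_cons hn hperp htop e
  have h : (Fin.cons (mfderiv 𝓘(ℝ, E) 𝓘(ℝ, E') f x n)
      (fun i => mfderiv 𝓘(ℝ, E) 𝓘(ℝ, E') f x (e i : TangentSpace 𝓘(ℝ, E) x)) :
      Fin (q + 1) → TangentSpace 𝓘(ℝ, E') (f x))
      = fun i => mfderiv 𝓘(ℝ, E) 𝓘(ℝ, E') f x (c i) := by
    funext i
    induction i using Fin.cases with
    | zero => rw [hc0]; rfl
    | succ i => rw [hc]; rfl
  rw [h, orthonormal_iff_ite]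
  intro i j
  rw [hf.inner_mfderiv]
  exact orthonormal_iff_ite.1 c.orthonormal i j

/-- `a + r - b ≤ a + s` if `r ≤ s` and `0 ≤ b`, with equality only for `b = 0` and `r = s`. -/
lemma ereal_le_and_eq_iff {a r b : ℝ} {s : EReal} (hs : (r : EReal) ≤ s) (hb : 0 ≤ b) :
    ((a + r - b : ℝ) : EReal) ≤ (a : EReal) + s ∧
      (((a + r - b : ℝ) : EReal) = (a : EReal) + s ↔ b = 0 ∧ (r : EReal) = s) := by
  induction s using EReal.rec with
  | bot => exact absurd hs (by simp)
  -- With an infinite supremum both sides of the equivalence are false, since a real number is never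
  -- `⊤`.
  | top =>
    rw [EReal.coe_add_top]
    exact ⟨le_top, ⟨fun h => absurd h (EReal.coe_ne_top _), fun h => absurd h.2 (EReal.coe_ne_top _)⟩⟩
  | coe s =>
    rw [← EReal.coe_add, EReal.coe_le_coe_iff, EReal.coe_eq_coe_iff, EReal.coe_eq_coe_iff]
    rw [EReal.coe_le_coe_iff] at hs
    refine ⟨by linarith, fun h => ⟨by linarith, by linarith⟩, fun h => by linarith [h.1, h.2]⟩

end RicciEstimate

end

end RiemannianImmersion

/-! ### The estimate and its equality case -/

theorem mainTheorem6
    {E : Type*} [NormedAddCommGroup E] [NormedSpace ℝ E] [FiniteDimensional ℝ E]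
    {M : Type*} [TopologicalSpace M] [ChartedSpace E M] [IsManifold 𝓘(ℝ, E) ∞ M]
    [RiemannianBundle (fun x : M => TangentSpace 𝓘(ℝ, E) x)]
    [IsContMDiffRiemannianBundle 𝓘(ℝ, E) ∞ E (fun x : M => TangentSpace 𝓘(ℝ, E) x)]
    {E' : Type*} [NormedAddCommGroup E'] [NormedSpace ℝ E'] [FiniteDimensional ℝ E']
    {M' : Type*} [TopologicalSpace M'] [ChartedSpace E' M'] [IsManifold 𝓘(ℝ, E') ∞ M']
    [RiemannianBundle (fun x : M' => TangentSpace 𝓘(ℝ, E') x)]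
    [IsContMDiffRiemannianBundle 𝓘(ℝ, E') ∞ E' (fun x : M' => TangentSpace 𝓘(ℝ, E') x)]
    (q : ℕ) (D : Fin 2 → ∀ x : M, Submodule ℝ (TangentSpace 𝓘(ℝ, E) x))
    (hD : IsAlmostProduct D ![1, q])
    (N : ∀ x : M, TangentSpace 𝓘(ℝ, E) x)
    (hN_smooth : ContMDiff 𝓘(ℝ, E) 𝓘(ℝ, E).tangent ∞
      (fun x => (⟨x, N x⟩ : TangentBundle 𝓘(ℝ, E) M)))
    (hN_unit : ∀ x, ‖N x‖ = 1)
    (hN_span : ∀ x, D 0 x = Submodule.span ℝ {N x})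
    (f : M → M') (hf : IsIsometricImmersion E E' f) :
    (∀ x, (ricci x (N x) (N x) : EReal) ≤
        ((1 / 4 * ‖meanCurvature E E' f x‖ ^ 2 : ℝ) : EReal)
          + supQRicci E' M' q) ∧
    (∀ x, ((ricci x (N x) (N x) : EReal) =
        ((1 / 4 * ‖meanCurvature E E' f x‖ ^ 2 : ℝ) : EReal)
          + supQRicci E' M' q ↔
      MixedTotallyGeodesicAt E E' f D x ∧
        meanCurvatureOn E E' f (D 0) x =
          meanCurvatureOn E E' f (D 1) x ∧
        AttainsSupQRicciAt E E' f N (D 1) q x)) ∧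
    ((∀ x, (ricci x (N x) (N x) : EReal) =
        ((1 / 4 * ‖meanCurvature E E' f x‖ ^ 2 : ℝ) : EReal)
          + supQRicci E' M' q) ↔
      MixedTotallyGeodesic E E' f D ∧
        (∀ x, meanCurvatureOn E E' f (D 0) x =
          meanCurvatureOn E E' f (D 1) x) ∧
        ∀ x, AttainsSupQRicciAt E E' f N (D 1) q x) := by
  have hperp : ∀ x, D 0 x ⟂ D 1 x := hD.orthogonal 0 1 (by decide)
  have htop : ∀ x, D 0 x ⊔ D 1 x = ⊤ := by
    intro x
    rw [eq_top_iff, ← hD.complementary x]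
    refine iSup_le fun i => ?_
    fin_cases i
    · exact le_sup_left
    · exact le_sup_right
  -- Here `b` is the defect in `ricci_eq`. Keeping `e` arbitrary allows the converse below to use
  -- the very basis supplied by `AttainsSupQRicciAt`.
  have key : ∀ x (e : OrthonormalBasis (Fin q) ℝ (D 1 x)), _ := fun x e =>
    ereal_le_and_eq_iff (a := 1 / 4 * ‖meanCurvature E E' f x‖ ^ 2)
      (b := 1 / 4 * ‖meanCurvatureOn E E' f (D 0) x - meanCurvatureOn E E' f (D 1) x‖ ^ 2
        + ∑ i, ‖secondFundamentalForm E E' f x (N x) (e i)‖ ^ 2)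
      (qRicci_le_supQRicci (f x) _ (hf.orthonormal_cons x (hN_unit x)
        (fun v hv => Submodule.isOrtho_iff_inner_eq.1 (hperp x) (N x)
          (hN_span x ▸ Submodule.mem_span_singleton_self (N x)) v hv)
        (hN_span x ▸ htop x) e)) (by positivity)
  simp only [← hf.ricci_eq _ (hN_unit _) (hN_span _) (hperp _) (htop _)] at key
  have basis : ∀ x, Nonempty (OrthonormalBasis (Fin q) ℝ (D 1 x)) := fun x =>
    ⟨(stdOrthonormalBasis ℝ (D 1 x)).reindex (finCongr ((hD.isDistribution 1).finrank_eq x))⟩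
  have hiff : ∀ x, ((ricci x (N x) (N x) : EReal) =
        ((1 / 4 * ‖meanCurvature E E' f x‖ ^ 2 : ℝ) : EReal) + supQRicci E' M' q ↔
      MixedTotallyGeodesicAt E E' f D x ∧
        meanCurvatureOn E E' f (D 0) x = meanCurvatureOn E E' f (D 1) x ∧
        AttainsSupQRicciAt E E' f N (D 1) q x) := by
    intro x
    constructor
    · intro h
      obtain ⟨e⟩ := basis x
      obtain ⟨hb, hr⟩ := (key x e).2.1 h
      -- A vanishing sum of nonnegative terms: each square in the defect is zero.
      have hb' := (add_eq_zero_iff_of_nonneg (by positivity)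
        (Finset.sum_nonneg fun i _ => by positivity)).1 hb
      have hzero : ∀ i, secondFundamentalForm E E' f x (N x) (e i) = 0 := fun i => by
        simpa using (Finset.sum_eq_zero_iff_of_nonneg fun i _ => by positivity).1 hb'.2 i
          (Finset.mem_univ i)
      have hmix : ∀ X ∈ D 0 x, ∀ Y ∈ D 1 x, secondFundamentalForm E E' f x X Y = 0 := by
        intro X hX Y hY
        rw [hN_span x, Submodule.mem_span_singleton] at hX
        obtain ⟨r, rfl⟩ := hX
        -- Bilinearity extends the vanishing from the pairs `(N x, e i)` to the whole of both
        -- subspaces.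
        obtain ⟨B, hB⟩ := hf.exists_secondFundamentalForm_bilinear x
        have hY' : Y = ∑ i, (inner ℝ (e i) (⟨Y, hY⟩ : D 1 x) : ℝ)
            • (e i : TangentSpace 𝓘(ℝ, E) x) := by
          simpa using (congrArg Subtype.val (e.sum_repr' (⟨Y, hY⟩ : D 1 x))).symm
        rw [← hB, hY', map_smul, LinearMap.smul_apply, map_sum]
        rw [Finset.sum_eq_zero fun i _ => by rw [map_smul, hB, hzero, smul_zero], smul_zero]
      refine ⟨?_, ?_, e, hr⟩
      · intro i j hij X hX Y hY
        fin_cases i <;> fin_cases j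
        · exact absurd rfl hij
        · exact hmix X hX Y hY
        · rw [hf.secondFundamentalForm_comm]
          exact hmix Y hY X hX
        · exact absurd rfl hij
      · simpa [sub_eq_zero] using hb'.1
    · rintro ⟨hmix, hH, e, hr⟩
      refine (key x e).2.2 ⟨?_, hr⟩
      have hzero : ∀ i, secondFundamentalForm E E' f x (N x) (e i) = 0 := fun i =>
        hmix 0 1 (by decide) (N x) (hN_span x ▸ Submodule.mem_span_singleton_self (N x)) _ (e i).2
      simp [hH, hzero]
  refine ⟨fun x => ?_, hiff, ?_⟩
  · obtain ⟨e⟩ := basis x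
    exact (key x e).1
  · simp only [hiff, forall_and, MixedTotallyGeodesic]
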